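/- Let $X=\{x_0,x_1,x_2,\dots\}$ be an infinite countable set, and write $n$ for $x_n$. For $n\ge 0$ define partial maps $\sigma_n,\gamma_n$ of $X$ by $$\sigma_n(k)=\begin{cases}k & k\le n\\ \text{undefined} & k=n+1\\ k-1 & k\ge n+2\end{cases}\qquad \gamma_n(k)=\begin{cases}k & k\le n-2\\ \text{undefined} & k=n-1\\ n & k=n\\ k+1 & k\ge n+1\end{cases}$$ and the partial map $r(x_i,x_j)=(x_{\sigma_i(j)},x_{\gamma_j(i)})$ on $X\times X$, with domain $\mathcal D$ the set of pairs at which both components are defined. Let $\mathcal F=(X,r)$. Then: (0) $\mathcal F$ is a square-free, non-degenerate, involutive partial set-theoretic solution of the Yang--Baxter equation. That is: $r(x,x)=(x,x)$ for all $x$; all $\sigma_x,\gamma_y$ are partial bijections of $X$ (injective on their domains); $x$ is in the domain of $\gamma_y$ if and only if $y$ is in the domain of $\sigma_x$; if $r(x,y)$ is defined, then $r(r(x,y))$ is defined and equals $(x,y)$; and $r^{12}r^{23}r^{12}=r^{23}r^{12}r^{23}$ at each triple where both sides are defined. (i) The structure group $G(X,r)=\operatorname{Gp}\langle X\mid xy=\sigma_x(y)\gamma_y(x),\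 (x,y)\in\mathcal D\rangle$ is isomorphic to Thompson's group $F$. Here $F$ is the group, under composition, of all dyadic rearrangements of $[0,1]$: the homeomorphisms of $[0,1]$ for which there are two dyadic subdivisions of $[0,1]$ (subdivisions obtained from $[0,1]$ by repeatedly cutting intervals in half) with the same number of intervals, such that each interval of the first is sent linearly and increasingly onto the corresponding interval of the second. (ii) The structure inverse monoid $\operatorname{IM}(X,r)=\operatorname{Inv}\langle X\mid xy=\sigma_x(y)\gamma_y(x),\ (x,y)\in\mathcal D\rangle$ (the quotient of the free inverse monoid on $X$ by the congruence generated by these relations) embeds into $A\Join \operatorname{I}_X$, that is, there is an injective monoid homomorphism $\operatorname{IM}(X,r)\to A\Join\operatorname{I}_X$, and both are inverse monoids. Here $A$ is the set of all partial functions $f:\mathcal D_f\to\mathbb Z$, $\mathcal D_f\subseteq X$, with pointwise addition on the intersection of the domains, $\operatorname{I}_X$ is the monoid of partial bijections of $X$ under composition, $\operatorname{I}_X$ acts on $A$ by $\tau\bullet f=f\circ\tau^{-1}$, and $A\Join\operatorname{I}_X$ is the set of pairs $(f,\tau)\in A\times \operatorname{I}_X$ such that the domain of $f$ is the range of $\tau$,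 with $(f,\tau)(g,\nu)=(f+\tau\bullet g,\ \tau\circ\nu)$. (iii) $\mathcal F$ is irretractable: no iterated retraction $\operatorname{Ret}^m(X,r)$ has exactly one point, where $\operatorname{Ret}(X,r)$ is the partial map that $r$ induces on the quotient of $X$ by the relation $x\sim y$ if and only if $\sigma_x=\sigma_y$ (including domains). $\mathcal F$ is decomposable: $X$ is the disjoint union of two non-empty subsets $Y$ that are invariant ($r(Y\times Y)\subseteq Y\times Y$ where defined) and such that the restriction of $r$ to $Y^2$ is again a non-degenerate involutive partial set-theoretic solution. (iv) The operation $x_n\star x_k=x_{\sigma_n^{-1}(k)}$ is defined on all of $X\times X$. Each left multiplication $x_n\star(-)$ is invertible as a partial bijection, namely a bijection of $X$ onto $X\setminus\{x_{n+1}\}$. It satisfies $(x\star y)\star(x\star z)=(y\star x)\star(y\star z)$ for all $x,y,z$, it is non-degenerate ($x\mapsto x\star x$ is a bijection of $X$), and it is square-free ($x\star x=x$). -/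

import Mathlib

/-! ### Partial braidings and partial set-theoretic solutions -/

/-- The data of a partial map `r(x,y) = (σ_x(y), γ_y(x))` on `X × X`: families of partial
self-maps `σ_x` and `γ_y` of `X` (`none` stands for "not defined"). -/
structure PartialBraiding (X : Type*) where
  /-- `σ x y` is `σ_x(y)` -/
  σ : X → X → Option X
  /-- `γ y x` is `γ_y(x)` -/
  γ : X → X → Option X

namespace PartialBraiding

variable {X : Type*}

/-- The partial map `r(x,y) = (σ_x(y), γ_y(x))`, defined at `(x,y)` if and only if both
`σ_x(y)` and `γ_y(x)` are defined. -/
def r (S : PartialBraiding X) (p : X × X) : Option (X × X) :=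
  (S.σ p.1 p.2).bind fun u => (S.γ p.2 p.1).map fun v => (u, v)

/-- `r` acting on the first two components of a triple. -/
def r12 (S : PartialBraiding X) (t : X × X × X) : Option (X × X × X) :=
  (S.r (t.1, t.2.1)).map fun p => (p.1, p.2, t.2.2)

/-- `r` acting on the last two components of a triple. -/
def r23 (S : PartialBraiding X) (t : X × X × X) : Option (X × X × X) :=
  (S.r t.2).map fun p => (t.1, p)

/-- All `σ_x` and `γ_y` are partial bijections of `X`. -/
def NonDegenerate (S : PartialBraiding X) : Prop :=
  (∀ x y z u, S.σ x y = some u → S.σ x z = some u → y = z) ∧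
  (∀ y x z u, S.γ y x = some u → S.γ y z = some u → x = z)

/-- `x` is in the domain of `γ_y` iff `y` is in the domain of `σ_x`, and whenever `r(x,y)` is
defined, so is `r(r(x,y))`, and it is `(x,y)`. -/
def Involutive (S : PartialBraiding X) : Prop :=
  (∀ x y, (S.γ y x).isSome ↔ (S.σ x y).isSome) ∧
  (∀ p q, S.r p = some q → S.r q = some p)

/-- `r¹² r²³ r¹² = r²³ r¹² r²³` wherever both sides are defined. -/
def Braided (S : PartialBraiding X) : Prop :=
  ∀ t a b : X × X × X,
    ((S.r12 t).bind S.r23).bind S.r12 = some a →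
    ((S.r23 t).bind S.r12).bind S.r23 = some b → a = b

/-- `r(x,x)` is defined and equal to `(x,x)` for all `x`. -/
def SquareFree (S : PartialBraiding X) : Prop :=
  ∀ x, S.r (x, x) = some (x, x)

/-- A non-degenerate involutive partial set-theoretic solution (on a non-empty set). -/
structure IsPartialSolution (S : PartialBraiding X) : Prop where
  nonempty : Nonempty X
  braided : S.Braided
  nonDegenerate : S.NonDegenerate
  involutive : S.Involutive

/-! ### The structure group -/

/-- `Gp⟨X ∣ xy = σ_x(y)γ_y(x), (x,y) ∈ 𝒟⟩` -/
abbrev StructureGroup (S : PartialBraiding X) : Type _ :=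
  PresentedGroup {w : FreeGroup X | ∃ x y u v, S.r (x, y) = some (u, v) ∧
    w = FreeGroup.of x * FreeGroup.of y * (FreeGroup.of u * FreeGroup.of v)⁻¹}

/-! ### Decomposability -/

/-- `r(Y × Y) ⊆ Y × Y` wherever `r` is defined on `Y × Y`. -/
def Invariant (S : PartialBraiding X) (Y : Set X) : Prop :=
  ∀ x ∈ Y, ∀ y ∈ Y, ∀ u v, S.r (x, y) = some (u, v) → u ∈ Y ∧ v ∈ Y

open Classical in
/-- The restriction to a subset `Y`. -/
noncomputable def restrict (S : PartialBraiding X) (Y : Set X) : PartialBraiding Y where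
  σ x y := (S.σ x y).bind fun u => if h : u ∈ Y then some ⟨u, h⟩ else none
  γ y x := (S.γ y x).bind fun u => if h : u ∈ Y then some ⟨u, h⟩ else none

/-- The set is the disjoint union of two non-empty non-degenerate invariant subsets. -/
def Decomposable (S : PartialBraiding X) : Prop :=
  ∃ Y Z : Set X, Y.Nonempty ∧ Z.Nonempty ∧ Disjoint Y Z ∧ Y ∪ Z = Set.univ ∧
    (S.Invariant Y ∧ (S.restrict Y).IsPartialSolution) ∧
    (S.Invariant Z ∧ (S.restrict Z).IsPartialSolution)

/-! ### Retractions -/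

/-- `x ∼ y` iff `σ_x` and `σ_y` have the same domain and agree on it. -/
def retractSetoid (S : PartialBraiding X) : Setoid X where
  r x y := S.σ x = S.σ y
  iseqv := ⟨fun _ => rfl, fun h => h.symm, fun h h' => h.trans h'⟩

open Classical in
/-- The retraction on `X/∼`, with `σ_[x]([y]) = [σ_x(y)]` and `γ_[y]([x]) = [γ_y(x)]`, a value
being defined as soon as it is defined for some representatives. -/
noncomputable def ret (S : PartialBraiding X) : PartialBraiding (Quotient S.retractSetoid) where
  σ a b := if h : ∃ c x y u, Quotient.mk _ x = a ∧ Quotient.mk _ y = b ∧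
      S.σ x y = some u ∧ Quotient.mk S.retractSetoid u = c then some h.choose else none
  γ b a := if h : ∃ c x y u, Quotient.mk _ x = a ∧ Quotient.mk _ y = b ∧
      S.γ y x = some u ∧ Quotient.mk S.retractSetoid u = c then some h.choose else none

/-- The `m`-th iterated retraction, with its underlying set. -/
noncomputable def iterRet {X : Type*} (S : PartialBraiding X) :
    ℕ → (Y : Type _) × PartialBraiding Y
  | 0 => ⟨X, S⟩
  | m + 1 => ⟨_, (iterRet S m).2.ret⟩

/-- No iterated retraction has exactly one point. -/
def Irretractable (S : PartialBraiding X) : Prop :=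
  ¬ ∃ m, Nat.card (S.iterRet m).1 = 1

/-! ### The induced cycle set -/

/-- The binary operation `⋆` is given by `x ⋆ y = σ_x⁻¹(y)`; in particular every `σ_x⁻¹` is
defined everywhere. -/
def InducesOperation (S : PartialBraiding X) (star : X → X → X) : Prop :=
  ∀ x y u, star x y = u ↔ S.σ x u = some y

end PartialBraiding

/-- The cycle identity `(x ⋆ y) ⋆ (x ⋆ z) = (y ⋆ x) ⋆ (y ⋆ z)`, where every left multiplication
is invertible as a partial bijection, that is, injective (not necessarily onto). -/
structure IsPartialCycleSet {X : Type*} (star : X → X → X) : Prop where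
  nonempty : Nonempty X
  injective : ∀ x, Function.Injective (star x)
  cycle : ∀ x y z, star (star x y) (star x z) = star (star y x) (star y z)

/-! ### Inverse monoids and the structure inverse monoid -/

/-- Every element has a unique inverse in the sense of inverse semigroups. -/
def IsInverseMonoid (M : Type*) [Monoid M] : Prop :=
  ∀ s : M, ∃! t : M, s * t * s = s ∧ t * s * t = t

/-- The involution on the free monoid on `X ⊔ X*`; `(x, true)` stands for `x` and `(x, false)`
for `x*`. -/
def invWord {X : Type*} (w : FreeMonoid (X × Bool)) : FreeMonoid (X × Bool) :=
  FreeMonoid.ofList ((FreeMonoid.toList w).map fun p => (p.1, !p.2)).reverse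

/-- The defining relations of the free inverse monoid. -/
inductive FreeInverseRel (X : Type*) : FreeMonoid (X × Bool) → FreeMonoid (X × Bool) → Prop
  | regular (u) : FreeInverseRel X u (u * invWord u * u)
  | comm (u v) : FreeInverseRel X (u * invWord u * (v * invWord v))
      (v * invWord v * (u * invWord u))

/-- The free inverse monoid on `X`. -/
abbrev FreeInverseMonoid (X : Type*) : Type _ := (conGen (FreeInverseRel X)).Quotient

/-- The generators of the free inverse monoid. -/
def FreeInverseMonoid.of {X : Type*} (x : X) : FreeInverseMonoid X :=
  ((FreeMonoid.of (x, true) : FreeMonoid (X × Bool)) : (conGen (FreeInverseRel X)).Quotient)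

namespace PartialBraiding

variable {X : Type*}

/-- The relations `xy = σ_x(y)γ_y(x)`, `(x,y) ∈ 𝒟`, in the free inverse monoid. -/
inductive InverseRel (S : PartialBraiding X) :
    FreeInverseMonoid X → FreeInverseMonoid X → Prop
  | rel (x y u v : X) : S.r (x, y) = some (u, v) →
      InverseRel S (FreeInverseMonoid.of x * FreeInverseMonoid.of y)
        (FreeInverseMonoid.of u * FreeInverseMonoid.of v)

/-- `Inv⟨X ∣ xy = σ_x(y)γ_y(x), (x,y) ∈ 𝒟⟩` -/
abbrev StructureInverseMonoid (S : PartialBraiding X) : Type _ :=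
  (conGen S.InverseRel).Quotient

end PartialBraiding

/-! ### The restricted product `A ⋈ I_X` -/

/-- The set `A ⋈ I_X` of pairs `(f, τ)` of a partial function `f : X → ℤ` (with arbitrary domain)
and a partial bijection `τ` of `X` such that the domain of `f` is the range of `τ`. -/
@[ext]
structure RestrictedInverseProduct (X : Type*) where
  /-- the partial function `f` -/
  fn : X → Option ℤ
  /-- the partial bijection `τ` -/
  perm : X ≃. X
  dom_eq : ∀ x, (fn x).isSome ↔ (perm.symm x).isSome

namespace RestrictedInverseProduct

variable {X : Type*}

/-- Pointwise sum of partial functions, on the intersection of the domains. -/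
def addFn (f g : X → Option ℤ) (x : X) : Option ℤ :=
  (f x).bind fun m => (g x).map fun n => m + n

/-- The action `τ • f = f ∘ τ⁻¹`. -/
def act (τ : X ≃. X) (f : X → Option ℤ) (x : X) : Option ℤ :=
  (τ.symm x).bind f

/-- `(f, τ)(g, ν) = (f + τ • g, τ ∘ ν)`, where `τ ∘ ν` applies `ν` first. -/
instance : Mul (RestrictedInverseProduct X) where
  mul a b :=
    { fn := addFn a.fn (act a.perm b.fn)
      perm := b.perm.trans a.perm
      dom_eq := by
        intro x
        have ha := a.dom_eq x
        have e : (b.perm.trans a.perm).symm x = (a.perm.symm x).bind b.perm.symm := rfl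
        rw [e]
        simp only [addFn, act]
        cases hf : a.fn x <;> cases hp : a.perm.symm x <;> simp_all
        exact Bool.eq_iff_iff.2 (b.dom_eq _) }

/-- The identity is the pair of the zero function on `X` and the identity of `X`. -/
instance : One (RestrictedInverseProduct X) where
  one := ⟨fun _ => some 0, PEquiv.refl X, fun _ => by simp⟩

theorem mul_fn (a b : RestrictedInverseProduct X) : (a * b).fn = addFn a.fn (act a.perm b.fn) := rfl

theorem mul_perm (a b : RestrictedInverseProduct X) : (a * b).perm = b.perm.trans a.perm := rfl

theorem one_fn : (1 : RestrictedInverseProduct X).fn = fun _ => some 0 := rfl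

theorem one_perm : (1 : RestrictedInverseProduct X).perm = PEquiv.refl X := rfl

instance : Monoid (RestrictedInverseProduct X) where
  mul_assoc a b c := by
    apply RestrictedInverseProduct.ext
    · funext x
      have e : (b.perm.trans a.perm).symm x = (a.perm.symm x).bind b.perm.symm := rfl
      simp only [mul_fn, mul_perm, addFn, act, e]
      cases a.fn x with
      | none => rfl
      | some m =>
        cases a.perm.symm x with
        | none => rfl
        | some y =>
          simp only [Option.bind_some, addFn, act]
          cases b.fn y with
          | none => rfl
          | some n =>
            simp only [Option.bind_some, Option.map_some]
            cases (b.perm.symm y).bind c.fn with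
            | none => rfl
            | some k => simp [add_assoc]
    · simp only [mul_perm, PEquiv.trans_assoc]
  one_mul a := by
    apply RestrictedInverseProduct.ext
    · funext x
      simp only [mul_fn, one_fn, one_perm, addFn, act, PEquiv.symm_refl, PEquiv.refl_apply,
        Option.bind_some]
      cases a.fn x <;> simp
    · simp [mul_perm, one_perm]
  mul_one a := by
    apply RestrictedInverseProduct.ext
    · funext x
      have ha := a.dom_eq x
      simp only [mul_fn, one_fn, addFn, act]
      cases hf : a.fn x <;> cases hp : a.perm.symm x <;> simp_all
    · simp [mul_perm, one_perm]

end RestrictedInverseProduct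

/-! ### Thompson's group `F` -/

/-- An interval `[a,b]`, given by its endpoints `(a,b)`, of a subdivision is cut in half. -/
inductive CutStep : List (ℝ × ℝ) → List (ℝ × ℝ) → Prop
  | cut (L R : List (ℝ × ℝ)) (a b : ℝ) :
      CutStep (L ++ (a, b) :: R) (L ++ (a, (a + b) / 2) :: ((a + b) / 2, b) :: R)

/-- The dyadic subdivisions of `[0,1]` (listed from left to right): those that are obtained by
repeatedly cutting intervals in half. -/
def IsDyadicSubdivision (L : List (ℝ × ℝ)) : Prop :=
  Relation.ReflTransGen CutStep [(0, 1)] L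

/-- `f` sends the interval `I = [a,b]` linearly (and increasingly) onto `J = [c,d]`. -/
def MapsLinearly (f : unitInterval → unitInterval) (I J : ℝ × ℝ) : Prop :=
  ∀ t ∈ Set.Icc (0 : ℝ) 1, ∃ x : unitInterval,
    (x : ℝ) = I.1 + t * (I.2 - I.1) ∧ (f x : ℝ) = J.1 + t * (J.2 - J.1)

/-- `f` sends each interval of a dyadic subdivision linearly onto the corresponding interval of
another dyadic subdivision with the same number of intervals. -/
def IsDyadicRearrangement (f : unitInterval → unitInterval) : Prop :=
  ∃ D R : List (ℝ × ℝ), IsDyadicSubdivision D ∧ IsDyadicSubdivision R ∧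
    List.Forall₂ (MapsLinearly f) D R

theorem MapsLinearly.comp {f g : unitInterval → unitInterval} {I J K : ℝ × ℝ}
    (hf : MapsLinearly f I J) (hg : MapsLinearly g J K) : MapsLinearly (g ∘ f) I K := by
  intro t ht
  obtain ⟨x, hx, hfx⟩ := hf t ht
  obtain ⟨y, hy, hgy⟩ := hg t ht
  have : f x = y := Subtype.ext (hfx.trans hy.symm)
  exact ⟨x, hx, by simpa [this] using hgy⟩

theorem MapsLinearly.left {f : unitInterval → unitInterval} {a b c d : ℝ}
    (hf : MapsLinearly f (a, b) (c, d)) :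
    MapsLinearly f (a, (a + b) / 2) (c, (c + d) / 2) := by
  intro t ht
  obtain ⟨x, hx, hfx⟩ := hf (t / 2) ⟨by linarith [ht.1], by linarith [ht.2]⟩
  exact ⟨x, by rw [hx]; ring, by rw [hfx]; ring⟩

theorem MapsLinearly.right {f : unitInterval → unitInterval} {a b c d : ℝ}
    (hf : MapsLinearly f (a, b) (c, d)) :
    MapsLinearly f ((a + b) / 2, b) ((c + d) / 2, d) := by
  intro t ht
  obtain ⟨x, hx, hfx⟩ := hf (1 / 2 + t / 2) ⟨by linarith [ht.1], by linarith [ht.2]⟩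
  exact ⟨x, by rw [hx]; ring, by rw [hfx]; ring⟩

theorem MapsLinearly.symm {f : unitInterval ≃ₜ unitInterval} {I J : ℝ × ℝ}
    (hf : MapsLinearly f I J) : MapsLinearly f.symm J I := by
  intro t ht
  obtain ⟨x, hx, hfx⟩ := hf t ht
  exact ⟨f x, hfx, by simpa using hx⟩

/-- A cut of the domain subdivision can be carried over to the range subdivision. -/
theorem exists_cut_range {f : unitInterval → unitInterval} {D D' R : List (ℝ × ℝ)}
    (h : List.Forall₂ (MapsLinearly f) D R) (hD : Relation.ReflTransGen CutStep D D') :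
    ∃ R', Relation.ReflTransGen CutStep R R' ∧ List.Forall₂ (MapsLinearly f) D' R' := by
  induction hD with
  | refl => exact ⟨R, .refl, h⟩
  | tail _ hs ih =>
    obtain ⟨R', hR, h'⟩ := ih
    cases hs with
    | cut L M a b =>
      have h1 := List.forall₂_take_append R' L ((a, b) :: M) (List.Forall₂.flip (R := flip _) h')
      have h2 := List.forall₂_drop_append R' L ((a, b) :: M) (List.Forall₂.flip (R := flip _) h')
      have e := List.take_append_drop L.length R'
      generalize List.take L.length R' = P at h1 e
      generalize List.drop L.length R' = Q at h2 e
      subst e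
      cases h2 with
      | @cons p _ Q _ hp hQ =>
        obtain ⟨c, d⟩ := p
        exact ⟨_, hR.tail (CutStep.cut P Q c d),
          List.rel_append h1.flip (.cons (MapsLinearly.left hp)
            (.cons (MapsLinearly.right hp) hQ.flip))⟩

/-- A cut of the range subdivision can be carried over to the domain subdivision. -/
theorem exists_cut_domain {f : unitInterval ≃ₜ unitInterval} {D R R' : List (ℝ × ℝ)}
    (h : List.Forall₂ (MapsLinearly f) D R) (hR : Relation.ReflTransGen CutStep R R') :
    ∃ D', Relation.ReflTransGen CutStep D D' ∧ List.Forall₂ (MapsLinearly f) D' R' := by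
  have h' : List.Forall₂ (MapsLinearly f.symm) R D :=
    List.Forall₂.flip (h.imp fun _ _ => MapsLinearly.symm)
  obtain ⟨D', hD, h''⟩ := exists_cut_range h' hR
  exact ⟨D', hD, List.Forall₂.flip (h''.imp fun _ _ hh => MapsLinearly.symm (f := f.symm) hh)⟩

/-- Two different cuts of one subdivision can be completed to a common subdivision. -/
theorem cutStep_diamond {A B C : List (ℝ × ℝ)} (hB : CutStep A B) (hC : CutStep A C) :
    ∃ D, Relation.ReflGen CutStep B D ∧ Relation.ReflTransGen CutStep C D := by
  cases hB with
  | cut L R a b =>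
    generalize hA : L ++ (a, b) :: R = A at hC
    cases hC with
    | cut L' R' a' b' =>
      rcases List.append_eq_append_iff.1 hA with ⟨M, h1, h2⟩ | ⟨M, h1, h2⟩
      · cases M with
        | nil =>
          simp only [List.nil_append, List.cons.injEq, Prod.mk.injEq] at h2
          obtain ⟨⟨rfl, rfl⟩, rfl⟩ := h2
          simp only [List.append_nil] at h1
          subst h1
          exact ⟨_, .refl, .refl⟩
        | cons p M =>
          simp only [List.cons_append, List.cons.injEq] at h2
          obtain ⟨rfl, rfl⟩ := h2
          subst h1
          refine ⟨L ++ (a, (a + b) / 2) :: ((a + b) / 2, b) ::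
            (M ++ (a', (a' + b') / 2) :: ((a' + b') / 2, b') :: R'), .single ?_, .single ?_⟩
          · have := CutStep.cut (L ++ (a, (a + b) / 2) :: ((a + b) / 2, b) :: M) R' a' b'
            simpa using this
          · have := CutStep.cut L (M ++ (a', (a' + b') / 2) :: ((a' + b') / 2, b') :: R') a b
            simpa using this
      · cases M with
        | nil =>
          simp only [List.nil_append, List.cons.injEq, Prod.mk.injEq] at h2
          obtain ⟨⟨rfl, rfl⟩, rfl⟩ := h2
          simp only [List.append_nil] at h1
          subst h1
          exact ⟨_, .refl, .refl⟩
        | cons p M =>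
          simp only [List.cons_append, List.cons.injEq] at h2
          obtain ⟨rfl, rfl⟩ := h2
          subst h1
          refine ⟨L' ++ (a', (a' + b') / 2) :: ((a' + b') / 2, b') ::
            (M ++ (a, (a + b) / 2) :: ((a + b) / 2, b) :: R), .single ?_, .single ?_⟩
          · have := CutStep.cut L' (M ++ (a, (a + b) / 2) :: ((a + b) / 2, b) :: R) a' b'
            simpa using this
          · have := CutStep.cut (L' ++ (a', (a' + b') / 2) :: ((a' + b') / 2, b') :: M) R a b
            simpa using this

theorem IsDyadicRearrangement.comp {f g : unitInterval ≃ₜ unitInterval}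
    (hf : IsDyadicRearrangement f) (hg : IsDyadicRearrangement g) :
    IsDyadicRearrangement (g ∘ f) := by
  obtain ⟨D, R, hD, hR, h⟩ := hf
  obtain ⟨D', R', hD', hR', h'⟩ := hg
  obtain ⟨U, hU, hU'⟩ := Relation.church_rosser (fun _ _ _ => cutStep_diamond) hR hD'
  obtain ⟨D₂, hD₂, k⟩ := exists_cut_domain h hU
  obtain ⟨R₂, hR₂, k'⟩ := exists_cut_range h' hU'
  refine ⟨D₂, R₂, hD.trans hD₂, hR'.trans hR₂, ?_⟩
  clear hU hU' hD₂ hR₂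
  induction k generalizing R₂ with
  | nil => cases k'; exact .nil
  | cons h₁ _ ih =>
    cases k' with
    | cons h₂ hs => exact .cons (h₁.comp h₂) (ih _ hs)

/-- Thompson's group `F`: the group of dyadic rearrangements of `[0,1]`, under composition. -/
def ThompsonF : Subgroup (unitInterval ≃ₜ unitInterval) where
  carrier := {f | IsDyadicRearrangement f}
  mul_mem' := fun {_ _} hf hg => IsDyadicRearrangement.comp hg hf
  one_mem' := ⟨[(0, 1)], [(0, 1)], .refl, .refl,
    .cons (fun t ht => ⟨⟨t, ht⟩, by simp, by simp⟩) .nil⟩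
  inv_mem' := by
    rintro f ⟨D, R, hD, hR, h⟩
    exact ⟨R, D, hR, hD, List.Forall₂.flip (h.imp fun _ _ => MapsLinearly.symm)⟩

/-! ### The partial solution `𝓕` on `X = {x₀, x₁, …}` (with `x_n` written `n`) -/

/-- The partial braiding `𝓕`. -/
def thompsonBraiding : PartialBraiding ℕ where
  σ n k := if k ≤ n then some k else if k = n + 1 then none else some (k - 1)
  γ n k := if k + 2 ≤ n then some k else if k + 1 = n then none else if k = n then some n
    else some (k + 1)

/-!
The solution is given by `r(n,k) = (k, n+1)` for `k < n`, `r(n,n) = (n,n)` and `r(n,k) = (k-1, n)`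
for `k ≥ n + 2`, so that the axioms of a solution, the invariance of `{0}` and of its complement,
and the identities of the cycle set are linear arithmetic. The `σ_n` are pairwise distinct, so that
retraction identifies no points (`irretractable_of_σ_injective`).

The relations of the structure group are those of the infinite presentation
`x_n x_k = x_k x_{n+1}`, `k < n`, of Thompson's group. It is represented on `[0,1]` by the
piecewise linear maps `x_n = Sⁿ(x₀)`, where `S` (`rightCopy`) copies a map to `[1/2,1]`; the
relations follow from `S(f) x₀ = x₀ S(S(f))`. Two facts make this an isomorphism onto `F`.

* Injectivity. If `s` is the endomorphism `x_n ↦ x_{n+1}` of the structure group, then every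
  element is obtained from `1` by iterating `h ↦ x₀ᵃ s(h) x₀⁻ᵇ` (`hasNormalForm`). If such an
  element acts trivially, then `a = b`, because `s(h)` fixes `1/2`, whereas `x₀` moves points of the open
  interval to the left; so `s(h)` and thereby `h` acts trivially, and one concludes by induction.
* Surjectivity. By induction on the number of cuts, each dyadic subdivision is sent linearly onto
  the subdivision `[0,1/2], [1/2,3/4], …` with the same number of intervals by an element of the
  image (`IsDyadicSubdivision.exists_map_comb`); the point is that, after a
  cut of its `i`-th interval (not the last), this `comb` is sent to the next one by `x_i⁻¹`. A
  dyadic rearrangement is then a quotient of two such elements.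

A monoid is inverse as soon as it is regular and its idempotents commute. This gives the claim for
the free inverse monoid and for `A ⋈ I_X`, and it passes to quotients by Lallement's lemma.

The embedding of the structure inverse monoid `M` combines the Wagner–Preston representation of
`M` by partial bijections of `M`, which is a countably infinite set just like `X`, with the degree
`M → ℤ`, `x ↦ 1`: it sends `s` to the left multiplication by `s`, restricted to
`{x ∣ s⁻¹ s x = x}`, together with the constant function `deg s` on its range. The assignment
`x_n ↦ (δ_n, σ_n)` would not do, for all `σ_n` are onto, so that it sends `x_n x_n⁻¹` to `1`,
although `x_n x_n⁻¹ ≠ 1` in `M`.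
-/

namespace PartialBraiding

variable {X : Type*} {S : PartialBraiding X}

theorem r_eq_some_iff {x y u v : X} :
    S.r (x, y) = some (u, v) ↔ S.σ x y = some u ∧ S.γ y x = some v := by
  simp only [r, Option.bind_eq_some_iff, Option.map_eq_some_iff, Prod.mk.injEq]
  constructor
  · rintro ⟨_, h, _, h', rfl, rfl⟩
    exact ⟨h, h'⟩
  · rintro ⟨h, h'⟩
    exact ⟨_, h, _, h', rfl, rfl⟩

theorem r12_eq_some_iff {x y z u v w : X} :
    S.r12 (x, y, z) = some (u, v, w) ↔ S.r (x, y) = some (u, v) ∧ z = w := by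
  simp only [r12, Option.map_eq_some_iff, Prod.mk.injEq, Prod.exists]
  constructor
  · rintro ⟨_, _, h, rfl, rfl, rfl⟩
    exact ⟨h, rfl⟩
  · rintro ⟨h, rfl⟩
    exact ⟨_, _, h, rfl, rfl, rfl⟩

theorem r23_eq_some_iff {x y z u v w : X} :
    S.r23 (x, y, z) = some (u, v, w) ↔ x = u ∧ S.r (y, z) = some (v, w) := by
  simp only [r23, Option.map_eq_some_iff, Prod.mk.injEq, Prod.exists]
  constructor
  · rintro ⟨_, _, h, rfl, rfl, rfl⟩
    exact ⟨rfl, h⟩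
  · rintro ⟨rfl, h⟩
    exact ⟨_, _, h, rfl, rfl, rfl⟩

/-! ### Restriction to invariant subsets -/

theorem restrict_σ_eq_some_iff {Y : Set X} {x y u : Y} :
    (S.restrict Y).σ x y = some u ↔ S.σ x y = some (u : X) := by
  simp only [restrict, Option.bind_eq_some_iff]
  constructor
  · rintro ⟨a, h, h'⟩
    split_ifs at h' with ha
    cases h'
    exact h
  · intro h
    exact ⟨u, h, by simp⟩

theorem restrict_γ_eq_some_iff {Y : Set X} {x y u : Y} :
    (S.restrict Y).γ y x = some u ↔ S.γ y x = some (u : X) := by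
  simp only [restrict, Option.bind_eq_some_iff]
  constructor
  · rintro ⟨a, h, h'⟩
    split_ifs at h' with ha
    cases h'
    exact h
  · intro h
    exact ⟨u, h, by simp⟩

theorem restrict_r_eq_some_iff {Y : Set X} {x y u v : Y} :
    (S.restrict Y).r (x, y) = some (u, v) ↔ S.r ((x : X), (y : X)) = some ((u : X), (v : X)) := by
  rw [r_eq_some_iff, r_eq_some_iff, restrict_σ_eq_some_iff, restrict_γ_eq_some_iff]

/-- Restricting a solution to an invariant subset gives a solution: by the first part of
involutivity, `σ_x(y)` and `γ_y(x)` are defined together, so that both stay in the subset. -/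
theorem IsPartialSolution.restrict (hS : S.IsPartialSolution) {Y : Set X} (hne : Y.Nonempty)
    (hY : S.Invariant Y) : (S.restrict Y).IsPartialSolution where
  nonempty := hne.to_subtype
  braided := by
    rintro ⟨x, y, z⟩ ⟨a₁, a₂, a₃⟩ ⟨b₁, b₂, b₃⟩ ha hb
    have key := hS.braided (x, y, z) (a₁, a₂, a₃) (b₁, b₂, b₃)
    simp only [Option.bind_eq_some_iff, Prod.exists, r12_eq_some_iff, r23_eq_some_iff,
      restrict_r_eq_some_iff] at ha hb key
    obtain ⟨c₁, c₂, c₃, ⟨d₁, d₂, d₃, ⟨h1, rfl⟩, rfl, h2⟩, h3, rfl⟩ := ha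
    obtain ⟨e₁, e₂, e₃, ⟨f₁, f₂, f₃, ⟨rfl, k1⟩, k2, rfl⟩, rfl, k3⟩ := hb
    have := key ⟨_, _, _, ⟨_, _, _, ⟨h1, rfl⟩, rfl, h2⟩, h3, rfl⟩
      ⟨_, _, _, ⟨_, _, _, ⟨rfl, k1⟩, k2, rfl⟩, rfl, k3⟩
    simpa [Subtype.ext_iff] using this
  nonDegenerate := by
    constructor
    · intro x y z u h h'
      rw [restrict_σ_eq_some_iff] at h h'
      exact Subtype.ext (hS.nonDegenerate.1 _ _ _ _ h h')
    · intro x y z u h h'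
      rw [restrict_γ_eq_some_iff] at h h'
      exact Subtype.ext (hS.nonDegenerate.2 _ _ _ _ h h')
  involutive := by
    refine ⟨fun x y => ?_, ?_⟩
    · simp only [Option.isSome_iff_exists, restrict_σ_eq_some_iff, restrict_γ_eq_some_iff]
      constructor
      · rintro ⟨v, hv⟩
        obtain ⟨u, hu⟩ := Option.isSome_iff_exists.1
          ((hS.involutive.1 x y).1 (Option.isSome_iff_exists.2 ⟨_, hv⟩))
        exact ⟨⟨u, (hY x x.2 y y.2 u v (r_eq_some_iff.2 ⟨hu, hv⟩)).1⟩, hu⟩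
      · rintro ⟨u, hu⟩
        obtain ⟨v, hv⟩ := Option.isSome_iff_exists.1
          ((hS.involutive.1 x y).2 (Option.isSome_iff_exists.2 ⟨_, hu⟩))
        exact ⟨⟨v, (hY x x.2 y y.2 u v (r_eq_some_iff.2 ⟨hu, hv⟩)).2⟩, hv⟩
    · rintro ⟨x, y⟩ ⟨u, v⟩ h
      rw [restrict_r_eq_some_iff] at h ⊢
      exact hS.involutive.2 _ _ h

/-! ### Retraction -/

theorem retract_mk_injective (hS : Function.Injective S.σ) :
    Function.Injective (Quotient.mk S.retractSetoid) :=
  fun _ _ h => hS (Quotient.exact h)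

theorem ret_σ_mk (hS : Function.Injective S.σ) (x y : X) :
    S.ret.σ (Quotient.mk _ x) (Quotient.mk _ y) = (S.σ x y).map (Quotient.mk _) := by
  have hinj := retract_mk_injective hS
  simp only [ret]
  split_ifs with h
  · obtain ⟨x', y', u, hx, hy, hu, hc⟩ := h.choose_spec
    rw [hinj hx, hinj hy] at hu
    rw [hu, Option.map_some, hc]
  · cases hu : S.σ x y with
    | none => rfl
    | some u => exact (h ⟨_, x, y, u, rfl, rfl, hu, rfl⟩).elim

theorem ret_σ_injective (hS : Function.Injective S.σ) : Function.Injective S.ret.σ := by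
  intro a b h
  induction a using Quotient.inductionOn with
  | h x =>
    induction b using Quotient.inductionOn with
    | h y =>
      congr 1
      apply hS
      funext z
      have hz := congrFun h (Quotient.mk _ z)
      rw [ret_σ_mk hS, ret_σ_mk hS] at hz
      exact Option.map_injective (retract_mk_injective hS) hz

/-- If the `σ_x` are pairwise distinct, retraction identifies no two points, so that the
iterated retractions of an infinite solution are all infinite. -/
theorem irretractable_of_σ_injective [Infinite X] (hS : Function.Injective S.σ) :
    S.Irretractable := by
  have key : ∀ m, Infinite (S.iterRet m).1 ∧ Function.Injective (S.iterRet m).2.σ := by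
    intro m
    induction m with
    | zero => exact ⟨‹_›, hS⟩
    | succ m ih =>
      have := ih.1
      exact ⟨Infinite.of_injective _ (retract_mk_injective ih.2), ret_σ_injective ih.2⟩
  rintro ⟨m, hm⟩
  have := (key m).1
  simp at hm

end PartialBraiding

/-! ### The solution `𝓕` and its cycle set -/

namespace thompsonBraiding

open PartialBraiding

theorem σ_eq_some_iff {n k u : ℕ} : thompsonBraiding.σ n k = some u ↔
    (k ≤ n ∧ u = k) ∨ (n + 2 ≤ k ∧ u + 1 = k) := by
  simp only [thompsonBraiding]
  split_ifs <;> simp <;> omega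

theorem γ_eq_some_iff {n k u : ℕ} : thompsonBraiding.γ n k = some u ↔
    (k + 2 ≤ n ∧ u = k) ∨ (k = n ∧ u = n) ∨ (n < k ∧ u = k + 1) := by
  simp only [thompsonBraiding]
  split_ifs <;> simp <;> omega

/-- The defining relations of the structure group and monoid are `x_n x_k = x_k x_{n+1}` for
`k < n`, the same relations read backwards, and the trivial ones. -/
theorem r_eq_some_iff {n k u v : ℕ} : thompsonBraiding.r (n, k) = some (u, v) ↔
    (k < n ∧ u = k ∧ v = n + 1) ∨ (k = n ∧ u = n ∧ v = n) ∨
      (n + 2 ≤ k ∧ u + 1 = k ∧ v = n) := by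
  rw [PartialBraiding.r_eq_some_iff, σ_eq_some_iff, γ_eq_some_iff]
  omega

theorem isPartialSolution : thompsonBraiding.IsPartialSolution where
  nonempty := ⟨0⟩
  braided := by
    rintro ⟨x, y, z⟩ ⟨a₁, a₂, a₃⟩ ⟨b₁, b₂, b₃⟩ ha hb
    simp only [Option.bind_eq_some_iff, Prod.exists, r12_eq_some_iff, r23_eq_some_iff,
      r_eq_some_iff] at ha hb
    obtain ⟨c₁, c₂, c₃, ⟨d₁, d₂, d₃, ⟨h1, rfl⟩, rfl, h2⟩, h3, rfl⟩ := ha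
    obtain ⟨e₁, e₂, e₃, ⟨f₁, f₂, f₃, ⟨rfl, k1⟩, k2, rfl⟩, rfl, k3⟩ := hb
    simp only [Prod.mk.injEq]
    omega
  nonDegenerate := by
    constructor
    · intro n k l u h h'
      rw [σ_eq_some_iff] at h h'
      omega
    · intro n k l u h h'
      rw [γ_eq_some_iff] at h h'
      omega
  involutive := by
    constructor
    · intro n k
      simp only [thompsonBraiding]
      split_ifs <;> simp <;> omega
    · rintro ⟨n, k⟩ ⟨u, v⟩ h
      rw [r_eq_some_iff] at h ⊢
      omega

theorem squareFree : thompsonBraiding.SquareFree := fun n => by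
  rw [r_eq_some_iff]
  omega

theorem σ_injective : Function.Injective thompsonBraiding.σ := by
  -- `n + 1` is the only point outside the domain of `σ_n`
  intro n m h
  have hn : thompsonBraiding.σ n (n + 1) = none := by simp [thompsonBraiding]
  rw [h] at hn
  simp only [thompsonBraiding] at hn
  split_ifs at hn with h1 h2
  omega

theorem decomposable : thompsonBraiding.Decomposable := by
  have h0 : thompsonBraiding.Invariant {0} := by
    rintro _ rfl _ rfl u v h
    rw [r_eq_some_iff] at h
    simp only [Set.mem_singleton_iff]
    omega
  have h1 : thompsonBraiding.Invariant {0}ᶜ := by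
    intro n hn k hk u v h
    rw [r_eq_some_iff] at h
    simp only [Set.mem_compl_iff, Set.mem_singleton_iff] at hn hk ⊢
    omega
  exact ⟨{0}, {0}ᶜ, ⟨0, rfl⟩, ⟨1, one_ne_zero⟩, disjoint_compl_right, Set.union_compl_self _,
    ⟨h0, isPartialSolution.restrict ⟨0, rfl⟩ h0⟩,
    ⟨h1, isPartialSolution.restrict ⟨1, one_ne_zero⟩ h1⟩⟩

/-- The operation `n ⋆ k = σ_n⁻¹(k)`. -/
def star (n k : ℕ) : ℕ := if k ≤ n then k else k + 1

theorem inducesOperation_star : thompsonBraiding.InducesOperation star := by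
  intro n k u
  rw [σ_eq_some_iff, star]
  split_ifs <;> omega

theorem star_injective (n : ℕ) : Function.Injective (star n) := by
  intro k l h
  simp only [star] at h
  split_ifs at h <;> omega

theorem isPartialCycleSet_star : IsPartialCycleSet star where
  nonempty := ⟨0⟩
  injective := star_injective
  cycle x y z := by grind [star]

theorem star_self (n : ℕ) : star n n = n := by simp [star]

theorem bijOn_star (n : ℕ) : Set.BijOn (star n) Set.univ {n + 1}ᶜ := by
  refine ⟨fun k _ => ?_, (star_injective n).injOn, fun k hk => ?_⟩
  · simp only [star, Set.mem_compl_iff, Set.mem_singleton_iff]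
    split_ifs <;> omega
  · simp only [Set.mem_compl_iff, Set.mem_singleton_iff] at hk
    refine ⟨if k ≤ n then k else k - 1, trivial, ?_⟩
    simp only [star]
    split_ifs <;> omega

end thompsonBraiding

/-! ### Inverse monoids -/

section InverseMonoid

variable {M N : Type*} [Monoid M] [Monoid N]

/-- A regular monoid whose idempotents commute is an inverse monoid. -/
theorem isInverseMonoid_of_regular_of_commute
    (hreg : ∀ s : M, ∃ t, s * t * s = s ∧ t * s * t = t)
    (hcomm : ∀ e f : M, e * e = e → f * f = f → e * f = f * e) : IsInverseMonoid M := by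
  intro s
  obtain ⟨t, hst, hts⟩ := hreg s
  refine ⟨t, ⟨hst, hts⟩, fun u hu => ?_⟩
  obtain ⟨hsu, hus⟩ := hu
  have h1 := hcomm (s * u) (s * t) (by rw [← mul_assoc, hsu]) (by rw [← mul_assoc, hst])
  have h2 := hcomm (u * s) (t * s) (by rw [← mul_assoc, hus]) (by rw [← mul_assoc, hts])
  calc u = u * s * u := hus.symm
    _ = u * (s * t * s) * u := by rw [hst]
    _ = u * ((s * t) * (s * u)) := by simp only [mul_assoc]
    _ = u * ((s * u) * (s * t)) := by rw [h1]
    _ = (u * s * u) * s * t := by simp only [mul_assoc]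
    _ = u * (s * t * s) * t := by rw [hus, hst]
    _ = ((u * s) * (t * s)) * t := by simp only [mul_assoc]
    _ = ((t * s) * (u * s)) * t := by rw [h2]
    _ = t * (s * u * s) * t := by simp only [mul_assoc]
    _ = t := by rw [hsu, hts]

/-- The product of two idempotents of an inverse monoid is idempotent: with `x` the inverse of
`e f`, uniqueness shows `x = f x e`, so that `x` is idempotent and hence inverse to itself. -/
theorem IsInverseMonoid.mul_idempotent (hM : IsInverseMonoid M) {e f : M}
    (he : e * e = e) (hf : f * f = f) : e * f * (e * f) = e * f := by
  obtain ⟨x, ⟨h1, h2⟩, huniq⟩ := hM (e * f)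
  have hx : f * x * e = x := by
    apply huniq
    constructor
    · calc e * f * (f * x * e) * (e * f) = e * (f * f) * x * (e * e) * f := by
            simp only [mul_assoc]
        _ = e * f * x * (e * f) := by rw [he, hf]; simp only [mul_assoc]
        _ = e * f := h1
    · calc f * x * e * (e * f) * (f * x * e) = f * (x * ((e * e) * (f * f)) * x) * e := by
            simp only [mul_assoc]
        _ = f * x * e := by rw [he, hf, h2]
  have hxx : x * x = x := by
    calc x * x = (f * x * e) * (f * x * e) := by rw [hx]
      _ = f * (x * (e * f) * x) * e := by simp only [mul_assoc]
      _ = x := by rw [h2, hx]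
  have : e * f = x := (hM x).unique ⟨h2, h1⟩ ⟨by rw [hxx, hxx], by rw [hxx, hxx]⟩
  rw [this, hxx]

/-- Idempotents of an inverse monoid commute, as `e f` and `f e` are both inverse to `e f`. -/
theorem IsInverseMonoid.commute_idempotent (hM : IsInverseMonoid M) {e f : M}
    (he : e * e = e) (hf : f * f = f) : e * f = f * e := by
  have h1 := hM.mul_idempotent he hf
  have h2 := hM.mul_idempotent hf he
  refine (hM (e * f)).unique ⟨by rw [h1, h1], by rw [h1, h1]⟩ ⟨?_, ?_⟩
  · calc e * f * (f * e) * (e * f) = e * (f * f) * (e * e) * f := by simp only [mul_assoc]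
      _ = e * f := by rw [he, hf, mul_assoc (e * f), h1]
  · calc f * e * (e * f) * (f * e) = f * (e * e) * (f * f) * e := by simp only [mul_assoc]
      _ = f * e := by rw [he, hf, mul_assoc (f * e), h2]

/-- An idempotent in the image of a regular monoid is the image of an idempotent
(Lallement's lemma). -/
theorem exists_idempotent_of_map (hM : ∀ s : M, ∃ t, s * t * s = s ∧ t * s * t = t)
    (φ : M →* N) {a : M} (ha : φ a * φ a = φ a) : ∃ e : M, e * e = e ∧ φ e = φ a := by
  obtain ⟨t, h1, h2⟩ := hM (a * a)
  refine ⟨a * t * a, ?_, ?_⟩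
  · calc a * t * a * (a * t * a) = a * (t * (a * a) * t) * a := by simp only [mul_assoc]
      _ = a * t * a := by rw [h2]
  · calc φ (a * t * a) = φ a * φ t * φ a := by simp
      _ = φ a * φ a * φ t * (φ a * φ a) := by rw [ha]
      _ = φ (a * a * t * (a * a)) := by simp only [map_mul]
      _ = φ a := by rw [h1, map_mul, ha]

theorem IsInverseMonoid.of_surjective (hM : IsInverseMonoid M) (φ : M →* N)
    (hφ : Function.Surjective φ) : IsInverseMonoid N := by
  have hreg : ∀ s : M, ∃ t, s * t * s = s ∧ t * s * t = t := fun s => (hM s).exists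
  refine isInverseMonoid_of_regular_of_commute (fun s => ?_) (fun e f he hf => ?_)
  · obtain ⟨a, rfl⟩ := hφ s
    obtain ⟨t, h1, h2⟩ := hreg a
    exact ⟨φ t, by rw [← map_mul, ← map_mul, h1], by rw [← map_mul, ← map_mul, h2]⟩
  · obtain ⟨a, rfl⟩ := hφ e
    obtain ⟨b, rfl⟩ := hφ f
    obtain ⟨e, he, hea⟩ := exists_idempotent_of_map hreg φ he
    obtain ⟨f, hf, hfb⟩ := exists_idempotent_of_map hreg φ hf
    rw [← hea, ← hfb, ← map_mul, ← map_mul, hM.commute_idempotent he hf]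

end InverseMonoid

/-! ### The free inverse monoid and its quotients -/

section FreeInverseMonoid

variable {X : Type*}

theorem invWord_invWord (w : FreeMonoid (X × Bool)) : invWord (invWord w) = w := by
  apply FreeMonoid.toList.injective
  simp [invWord, List.map_reverse, Function.comp_def]

theorem invWord_mul (v w : FreeMonoid (X × Bool)) :
    invWord (v * w) = invWord w * invWord v := by
  apply FreeMonoid.toList.injective
  simp [invWord]

theorem freeInverseMonoid_regular (w : FreeMonoid (X × Bool)) :
    (w : FreeInverseMonoid X) * (invWord w : FreeMonoid (X × Bool)) * w = w :=
  ((conGen (FreeInverseRel X)).eq.2 (ConGen.Rel.of _ _ (FreeInverseRel.regular w))).symm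

/-- The idempotents `u u*` of the free inverse monoid commute by definition. Hence, for `e`
idempotent, `e* = e* e e* = (e* e)(e e*)` is idempotent too, so that `e = e e* e = (e e*)(e* e)`
is a product of two idempotents of that form. -/
theorem isInverseMonoid_freeInverseMonoid (X : Type*) :
    IsInverseMonoid (FreeInverseMonoid X) := by
  have hcomm : ∀ u v : FreeMonoid (X × Bool),
      Commute ((u : FreeInverseMonoid X) * (invWord u : FreeMonoid (X × Bool)))
        (v * (invWord v : FreeMonoid (X × Bool))) :=
    fun u v => (conGen (FreeInverseRel X)).eq.2 (ConGen.Rel.of _ _ (FreeInverseRel.comm u v))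
  have hreg := freeInverseMonoid_regular (X := X)
  have hreg' : ∀ w : FreeMonoid (X × Bool), ((invWord w : FreeMonoid (X × Bool)) :
      FreeInverseMonoid X) * w * (invWord w : FreeMonoid (X × Bool)) =
        (invWord w : FreeMonoid (X × Bool)) := fun w => by
    simpa only [invWord_invWord] using hreg (invWord w)
  have key : ∀ e : FreeInverseMonoid X, e * e = e → ∃ u v : FreeMonoid (X × Bool),
      e = u * (invWord u : FreeMonoid (X × Bool)) * (v * (invWord v : FreeMonoid (X × Bool))) := by
    intro e he
    induction e using Con.induction_on with
    | H w =>
      have h := hcomm w (invWord w)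
      have h1 := hreg w
      have h2 := hreg' w
      refine ⟨w, invWord w, ?_⟩
      rw [invWord_invWord] at h ⊢
      generalize (w : FreeInverseMonoid X) = e at *
      generalize ((invWord w : FreeMonoid (X × Bool)) : FreeInverseMonoid X) = f at *
      have hf : f = f * e * (e * f) := by
        rw [← mul_assoc, mul_assoc f e e, he, h2]
      have hff : f * f = f := by
        calc f * f = f * e * (e * f) * (f * e * (e * f)) := by rw [← hf]
          _ = f * e * (e * f * (f * e)) * (e * f) := by simp only [mul_assoc]
          _ = f * e * (f * e * (e * f)) * (e * f) := by rw [h.eq]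
          _ = (f * e * f) * e * (e * f * e) * f := by simp only [mul_assoc]
          _ = f * e * (e * f) := by rw [h1, h2]; simp only [mul_assoc]
          _ = f := hf.symm
      rw [← mul_assoc, mul_assoc e f f, hff, h1]
  refine isInverseMonoid_of_regular_of_commute (fun s => ?_) (fun e f he hf => ?_)
  · induction s using Con.induction_on with
    | H w => exact ⟨_, hreg w, hreg' w⟩
  · obtain ⟨u, v, rfl⟩ := key e he
    obtain ⟨u', v', rfl⟩ := key f hf
    exact (((hcomm u u').mul_right (hcomm u v')).mul_left
      ((hcomm v u').mul_right (hcomm v v'))).eq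

theorem isInverseMonoid_structureInverseMonoid (S : PartialBraiding X) :
    IsInverseMonoid S.StructureInverseMonoid :=
  (isInverseMonoid_freeInverseMonoid X).of_surjective (conGen S.InverseRel).mk'
    Con.mk'_surjective

end FreeInverseMonoid

/-! ### The inverse monoid `A ⋈ I_X` -/

namespace RestrictedInverseProduct

variable {X : Type*}

theorem mul_fn_eq_some_iff {a b : RestrictedInverseProduct X} {x : X} {k : ℤ} :
    (a * b).fn x = some k ↔
      ∃ y m n, a.fn x = some m ∧ a.perm.symm x = some y ∧ b.fn y = some n ∧ m + n = k := by
  simp only [mul_fn, addFn, act, Option.bind_eq_some_iff, Option.map_eq_some_iff]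
  constructor
  · rintro ⟨m, hm, n, ⟨y, hy, hn⟩, h⟩
    exact ⟨y, m, n, hm, hy, hn, h⟩
  · rintro ⟨y, m, n, hm, hy, hn, h⟩
    exact ⟨m, hm, n, ⟨y, hy, hn⟩, h⟩

/-- Two elements agree as soon as their functions and the inverses of their partial bijections
do, on the common domain. -/
theorem ext_symm {a b : RestrictedInverseProduct X} (hf : ∀ x, a.fn x = b.fn x)
    (hp : ∀ x, a.perm.symm x = b.perm.symm x) : a = b := by
  apply RestrictedInverseProduct.ext (funext hf)
  rw [← a.perm.symm_symm, ← b.perm.symm_symm, PEquiv.ext hp]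

/-- The inverse `(-f ∘ τ, τ⁻¹)` of `(f, τ)`. -/
def inverse (a : RestrictedInverseProduct X) : RestrictedInverseProduct X where
  fn x := ((a.perm x).bind a.fn).map fun m => -m
  perm := a.perm.symm
  dom_eq x := by
    rw [PEquiv.symm_symm]
    cases h : a.perm x with
    | none => simp
    | some y =>
      have h' := (a.perm.eq_some_iff).2 h
      have := (a.dom_eq y).2 (by simp [h'])
      simpa using this

theorem exists_perm_symm {a : RestrictedInverseProduct X} {x : X} {m : ℤ} (h : a.fn x = some m) :
    ∃ y, a.perm.symm x = some y ∧ a.perm y = some x := by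
  obtain ⟨y, hy⟩ := Option.isSome_iff_exists.1 ((a.dom_eq x).1 (by rw [h]; rfl))
  exact ⟨y, hy, a.perm.eq_some_iff.1 hy⟩

theorem perm_symm_eq_none {a : RestrictedInverseProduct X} {x : X} (h : a.fn x = none) :
    a.perm.symm x = none := by
  have := a.dom_eq x
  rw [h] at this
  simpa using this

theorem mul_perm_symm (a b : RestrictedInverseProduct X) (x : X) :
    (a * b).perm.symm x = (a.perm.symm x).bind b.perm.symm := rfl

theorem mul_inverse_mul (a : RestrictedInverseProduct X) : a * a.inverse * a = a := by
  apply ext_symm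
  · intro x
    simp only [mul_fn, addFn, act, mul_perm_symm]
    cases h : a.fn x with
    | none => rfl
    | some m =>
      obtain ⟨y, hy, hy'⟩ := exists_perm_symm h
      simp [inverse, hy, hy', h]
  · intro x
    simp only [mul_perm_symm]
    cases hy : a.perm.symm x with
    | none => rfl
    | some y =>
      have hy' := a.perm.eq_some_iff.1 hy
      simp [inverse, hy, hy']

theorem inverse_inverse (a : RestrictedInverseProduct X) : a.inverse.inverse = a := by
  apply ext_symm
  · intro x
    cases h : a.fn x with
    | none => simp [inverse, perm_symm_eq_none h]
    | some m =>
      obtain ⟨y, hy, hy'⟩ := exists_perm_symm h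
      simp [inverse, hy, hy', h]
  · intro x
    rfl

/-- The idempotents are the pairs of the zero function and the identity of a subset. -/
theorem eq_of_idempotent {e : RestrictedInverseProduct X} (he : e * e = e) {x : X} {m : ℤ}
    (h : e.fn x = some m) : m = 0 ∧ e.perm.symm x = some x := by
  obtain ⟨y, hy, -⟩ := exists_perm_symm h
  have hyx : e.perm.symm x = some x := by
    have h1 : (e * e).perm.symm x = some y := by rw [he, hy]
    rw [mul_perm_symm, hy, Option.bind_some] at h1
    rw [e.perm.symm.inj h1 hy] at hy
    exact hy
  refine ⟨?_, hyx⟩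
  have h1 : (e * e).fn x = some m := by rw [he, h]
  rw [mul_fn, addFn, act, hyx, h, Option.bind_some, Option.bind_some, h] at h1
  simpa using h1

theorem isInverseMonoid (X : Type*) : IsInverseMonoid (RestrictedInverseProduct X) := by
  refine isInverseMonoid_of_regular_of_commute (fun a => ⟨a.inverse, a.mul_inverse_mul, ?_⟩) ?_
  · simpa only [inverse_inverse] using a.inverse.mul_inverse_mul
  · intro e f he hf
    apply ext_symm
    · intro x
      simp only [mul_fn, addFn, act]
      cases h : e.fn x with
      | none =>
        cases h' : f.fn x with
        | none => rfl
        | some n =>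
          obtain ⟨rfl, hx'⟩ := eq_of_idempotent hf h'
          simp [hx', h]
      | some m =>
        obtain ⟨rfl, hx⟩ := eq_of_idempotent he h
        cases h' : f.fn x with
        | none => simp [hx, h']
        | some n =>
          obtain ⟨rfl, hx'⟩ := eq_of_idempotent hf h'
          simp [hx, hx', h, h']
    · intro x
      simp only [mul_perm_symm]
      cases h : e.fn x with
      | none =>
        rw [perm_symm_eq_none h]
        cases h' : f.fn x with
        | none => simp [perm_symm_eq_none h']
        | some n => simp [(eq_of_idempotent hf h').2, perm_symm_eq_none h]
      | some m =>
        rw [(eq_of_idempotent he h).2]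
        cases h' : f.fn x with
        | none => simp [perm_symm_eq_none h']
        | some n => simp [(eq_of_idempotent hf h').2, (eq_of_idempotent he h).2]

end RestrictedInverseProduct

/-! ### The Wagner–Preston representation with a degree -/

section WagnerPreston

variable {M X : Type*} [Monoid M]

/-- An inverse in the sense of inverse semigroups. -/
noncomputable def IsInverseMonoid.inv (hM : IsInverseMonoid M) (s : M) : M := (hM s).choose

theorem IsInverseMonoid.mul_inv_mul (hM : IsInverseMonoid M) (s : M) :
    s * hM.inv s * s = s := (hM s).choose_spec.1.1

theorem IsInverseMonoid.inv_mul_inv (hM : IsInverseMonoid M) (s : M) :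
    hM.inv s * s * hM.inv s = hM.inv s := (hM s).choose_spec.1.2

theorem IsInverseMonoid.eq_inv (hM : IsInverseMonoid M) {s t : M} (h : s * t * s = s)
    (h' : t * s * t = t) : t = hM.inv s :=
  (hM s).unique ⟨h, h'⟩ ⟨hM.mul_inv_mul s, hM.inv_mul_inv s⟩

theorem IsInverseMonoid.inv_one (hM : IsInverseMonoid M) : hM.inv 1 = 1 :=
  (hM.eq_inv (by simp) (by simp)).symm

theorem IsInverseMonoid.inv_mul_idempotent (hM : IsInverseMonoid M) (s : M) :
    hM.inv s * s * (hM.inv s * s) = hM.inv s * s := by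
  rw [← mul_assoc, hM.inv_mul_inv]

theorem IsInverseMonoid.mul_inv_idempotent (hM : IsInverseMonoid M) (s : M) :
    s * hM.inv s * (s * hM.inv s) = s * hM.inv s := by
  rw [← mul_assoc, hM.mul_inv_mul]

theorem IsInverseMonoid.inv_mul (hM : IsInverseMonoid M) (s t : M) :
    hM.inv (s * t) = hM.inv t * hM.inv s := by
  have h := hM.commute_idempotent (hM.inv_mul_idempotent s) (hM.mul_inv_idempotent t)
  symm
  apply hM.eq_inv
  · calc s * t * (hM.inv t * hM.inv s) * (s * t)
        = s * ((t * hM.inv t) * (hM.inv s * s)) * t := by simp only [mul_assoc]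
      _ = (s * hM.inv s * s) * (t * hM.inv t * t) := by rw [← h]; simp only [mul_assoc]
      _ = s * t := by rw [hM.mul_inv_mul, hM.mul_inv_mul]
  · calc hM.inv t * hM.inv s * (s * t) * (hM.inv t * hM.inv s)
        = hM.inv t * ((hM.inv s * s) * (t * hM.inv t)) * hM.inv s := by simp only [mul_assoc]
      _ = (hM.inv t * t * hM.inv t) * (hM.inv s * s * hM.inv s) := by
        rw [h]; simp only [mul_assoc]
      _ = hM.inv t * hM.inv s := by rw [hM.inv_mul_inv, hM.inv_mul_inv]

/-- The range `{x ∣ s s⁻¹ x = x}` of left multiplication by `s` restricted to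
`{x ∣ s⁻¹ s x = x}`, intersected for a product. -/
theorem IsInverseMonoid.mem_range_mul_iff (hM : IsInverseMonoid M) (s t x : M) :
    s * t * hM.inv (s * t) * x = x ↔
      s * hM.inv s * x = x ∧ t * hM.inv t * (hM.inv s * x) = hM.inv s * x := by
  have h := hM.commute_idempotent (hM.inv_mul_idempotent s) (hM.mul_inv_idempotent t)
  rw [hM.inv_mul]
  constructor
  · intro hx
    constructor
    · calc s * hM.inv s * x
          = s * hM.inv s * (s * t * (hM.inv t * hM.inv s) * x) := by rw [hx]
        _ = (s * hM.inv s * s) * t * (hM.inv t * hM.inv s) * x := by simp only [mul_assoc]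
        _ = x := by rw [hM.mul_inv_mul, hx]
    · calc t * hM.inv t * (hM.inv s * x)
          = t * hM.inv t * (hM.inv s * (s * t * (hM.inv t * hM.inv s) * x)) := by rw [hx]
        _ = t * hM.inv t * ((hM.inv s * s) * (t * hM.inv t)) * hM.inv s * x := by
          simp only [mul_assoc]
        _ = (t * hM.inv t * t) * hM.inv t * (hM.inv s * s * hM.inv s) * x := by
          rw [h]; simp only [mul_assoc]
        _ = ((t * hM.inv t) * (hM.inv s * s)) * hM.inv s * x := by
          rw [hM.mul_inv_mul, mul_assoc (t * hM.inv t) (hM.inv s * s), hM.inv_mul_inv]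
        _ = hM.inv s * (s * t * (hM.inv t * hM.inv s) * x) := by
          rw [← h]; simp only [mul_assoc]
        _ = hM.inv s * x := by rw [hx]
  · rintro ⟨h1, h2⟩
    calc s * t * (hM.inv t * hM.inv s) * x = s * (t * hM.inv t * (hM.inv s * x)) := by
          simp only [mul_assoc]
      _ = x := by rw [h2, ← mul_assoc, h1]

open Classical in
/-- The Wagner–Preston representation: `s` acts by left multiplication as a bijection from
`{x ∣ s⁻¹ s x = x}` onto `{x ∣ s s⁻¹ x = x}`, transported along a bijection `e` of the monoid with
`X`. -/
noncomputable def wagnerPreston (hM : IsInverseMonoid M) (e : M ≃ X) (s : M) : X ≃. X where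
  toFun k := if hM.inv s * s * e.symm k = e.symm k then some (e (s * e.symm k)) else none
  invFun k := if s * hM.inv s * e.symm k = e.symm k then some (e (hM.inv s * e.symm k)) else none
  inv k l := by
    have h1 := hM.mul_inv_mul s
    have h2 := hM.inv_mul_inv s
    simp only [Option.ite_none_right_eq_some, Option.some.injEq]
    constructor
    · rintro ⟨h, rfl⟩
      simp only [Equiv.symm_apply_apply]
      simp only [← mul_assoc, h2, h, e.apply_symm_apply]
      simp
    · rintro ⟨h, rfl⟩
      simp only [Equiv.symm_apply_apply]
      simp only [← mul_assoc, h1, h, e.apply_symm_apply]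
      simp

theorem wagnerPreston_eq_some_iff (hM : IsInverseMonoid M) (e : M ≃ X) (s : M) {k l : X} :
    wagnerPreston hM e s k = some l ↔
      hM.inv s * s * e.symm k = e.symm k ∧ e (s * e.symm k) = l := by
  classical
  change ite _ _ _ = _ ↔ _
  simp

theorem wagnerPreston_symm_eq_some_iff (hM : IsInverseMonoid M) (e : M ≃ X) (s : M) {k l : X} :
    (wagnerPreston hM e s).symm k = some l ↔
      s * hM.inv s * e.symm k = e.symm k ∧ e (hM.inv s * e.symm k) = l := by
  classical
  change ite _ _ _ = _ ↔ _
  simp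

open Classical in
/-- The Wagner–Preston representation, each partial bijection being accompanied by the constant
function on its range whose value is the degree `d s`. -/
noncomputable def gradedWagnerPreston (hM : IsInverseMonoid M) (e : M ≃ X)
    (d : M →* Multiplicative ℤ) : M →* RestrictedInverseProduct X where
  toFun s :=
    { fn := fun k => if s * hM.inv s * e.symm k = e.symm k then some (d s).toAdd else none
      perm := wagnerPreston hM e s
      dom_eq := fun k => by
        simp [Option.isSome_iff_exists, wagnerPreston_symm_eq_some_iff] }
  map_one' := by
    apply RestrictedInverseProduct.ext_symm
    · intro k
      simp [hM.inv_one, RestrictedInverseProduct.one_fn]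
    · intro k
      ext l
      simp [wagnerPreston_symm_eq_some_iff, hM.inv_one, RestrictedInverseProduct.one_perm]
  map_mul' s t := by
    apply RestrictedInverseProduct.ext_symm
    · intro k
      ext n
      simp only [RestrictedInverseProduct.mul_fn_eq_some_iff, wagnerPreston_symm_eq_some_iff,
        hM.mem_range_mul_iff, Option.ite_none_right_eq_some, Option.some.injEq, map_mul,
        toAdd_mul]
      constructor
      · rintro ⟨⟨h1, h2⟩, rfl⟩
        exact ⟨_, _, _, ⟨h1, rfl⟩, ⟨h1, rfl⟩, ⟨by rw [e.symm_apply_apply, h2], rfl⟩, rfl⟩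
      · rintro ⟨_, _, _, ⟨h1, rfl⟩, ⟨-, rfl⟩, ⟨h2, rfl⟩, rfl⟩
        rw [e.symm_apply_apply] at h2
        exact ⟨⟨h1, h2⟩, rfl⟩
    · intro k
      ext l
      simp only [RestrictedInverseProduct.mul_perm_symm, wagnerPreston_symm_eq_some_iff,
        hM.mem_range_mul_iff, Option.bind_eq_some_iff]
      constructor
      · rintro ⟨⟨h1, h2⟩, rfl⟩
        exact ⟨_, ⟨h1, rfl⟩, by rw [e.symm_apply_apply, h2],
          by rw [e.symm_apply_apply, hM.inv_mul, mul_assoc]⟩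
      · rintro ⟨_, ⟨h1, rfl⟩, h2, rfl⟩
        rw [e.symm_apply_apply] at h2
        exact ⟨⟨h1, h2⟩, by rw [e.symm_apply_apply, hM.inv_mul, mul_assoc]⟩

theorem gradedWagnerPreston_injective (hM : IsInverseMonoid M) (e : M ≃ X)
    (d : M →* Multiplicative ℤ) : Function.Injective (gradedWagnerPreston hM e d) := by
  intro s t h
  have hp : wagnerPreston hM e s = wagnerPreston hM e t :=
    congrArg RestrictedInverseProduct.perm h
  -- `s⁻¹ s` lies in the domain of the action of `s`, hence in that of the action of `t`,
  -- and both send it to `s`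
  have key : ∀ s t : M, wagnerPreston hM e s = wagnerPreston hM e t →
      hM.inv t * t * (hM.inv s * s) = hM.inv s * s ∧ t * (hM.inv s * s) = s := by
    intro s t hp
    have h1 : wagnerPreston hM e s (e (hM.inv s * s)) = some (e s) := by
      rw [wagnerPreston_eq_some_iff, e.symm_apply_apply, ← mul_assoc s, hM.mul_inv_mul]
      exact ⟨hM.inv_mul_idempotent s, rfl⟩
    rw [hp, wagnerPreston_eq_some_iff, e.symm_apply_apply] at h1
    exact ⟨h1.1, e.injective h1.2⟩
  obtain ⟨h1, h2⟩ := key s t hp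
  obtain ⟨h3, -⟩ := key t s hp.symm
  have h4 := hM.commute_idempotent (hM.inv_mul_idempotent s) (hM.inv_mul_idempotent t)
  rw [← h2, ← h1, ← h4, h3, ← mul_assoc, hM.mul_inv_mul]

end WagnerPreston

/-! ### The degree, and the embedding of the structure inverse monoid -/

section Degree

variable {X : Type*}

/-- The degree of a word: the number of letters `x` minus the number of letters `x*`. -/
def wordDegree (X : Type*) : FreeMonoid (X × Bool) →* Multiplicative ℤ :=
  FreeMonoid.lift fun p => if p.2 then Multiplicative.ofAdd 1 else (Multiplicative.ofAdd 1)⁻¹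

theorem wordDegree_invWord (w : FreeMonoid (X × Bool)) :
    wordDegree X (invWord w) = (wordDegree X w)⁻¹ := by
  induction w using FreeMonoid.inductionOn' with
  | one => rfl
  | of_mul p w ih =>
    rw [invWord_mul, map_mul, map_mul, ih, mul_inv, mul_comm]
    congr 1
    obtain ⟨x, b⟩ := p
    cases b <;> simp [wordDegree, invWord]

/-- The degree on the free inverse monoid. -/
def freeInverseDegree (X : Type*) : FreeInverseMonoid X →* Multiplicative ℤ :=
  (conGen (FreeInverseRel X)).lift (wordDegree X) (Con.conGen_le.2 fun u v h => by
    rw [Con.ker_rel]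
    cases h <;> simp only [map_mul, wordDegree_invWord] <;> simp)

theorem freeInverseDegree_of (x : X) :
    freeInverseDegree X (FreeInverseMonoid.of x) = Multiplicative.ofAdd 1 := by
  simp [freeInverseDegree, FreeInverseMonoid.of, wordDegree]

/-- The degree on the structure inverse monoid, whose defining relations are homogeneous. -/
def PartialBraiding.degree (S : PartialBraiding X) :
    S.StructureInverseMonoid →* Multiplicative ℤ :=
  (conGen S.InverseRel).lift (freeInverseDegree X) (Con.conGen_le.2 fun u v h => by
    rw [Con.ker_rel]
    cases h
    simp only [map_mul, freeInverseDegree_of])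

theorem PartialBraiding.infinite_structureInverseMonoid [Nonempty X] (S : PartialBraiding X) :
    Infinite S.StructureInverseMonoid := by
  obtain ⟨x⟩ := ‹Nonempty X›
  refine Infinite.of_injective
    (fun n : ℕ => (conGen S.InverseRel).mk' (FreeInverseMonoid.of x) ^ n) fun m n h => ?_
  have h' := congrArg S.degree h
  have hx : S.degree ((conGen S.InverseRel).mk' (FreeInverseMonoid.of x)) =
      Multiplicative.ofAdd 1 := freeInverseDegree_of x
  simp only [map_pow, hx] at h'
  simpa [← ofAdd_nsmul] using h'

instance PartialBraiding.countable_structureInverseMonoid [Countable X] (S : PartialBraiding X) :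
    Countable S.StructureInverseMonoid := by
  have : Countable (FreeMonoid (X × Bool)) := inferInstanceAs (Countable (List (X × Bool)))
  have : Countable (FreeInverseMonoid X) := Con.mk'_surjective.countable
  exact Con.mk'_surjective.countable

/-- The monoid is countably infinite, so that the set on which the Wagner–Preston representation
acts may be identified with `X`. -/
theorem PartialBraiding.exists_embedding [Nonempty X] [Countable X] [Infinite X]
    (S : PartialBraiding X) :
    ∃ ψ : S.StructureInverseMonoid →* RestrictedInverseProduct X, Function.Injective ψ := by
  have := S.infinite_structureInverseMonoid
  obtain ⟨e⟩ := nonempty_equiv_of_countable (α := S.StructureInverseMonoid) (β := X)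
  exact ⟨_, gradedWagnerPreston_injective (isInverseMonoid_structureInverseMonoid S) e S.degree⟩

end Degree

/-! ### Increasing bijections of the unit interval -/

namespace ThompsonF

/-- The homeomorphism underlying an increasing bijection of `[0,1]`. -/
def orderIsoToHomeomorph : (unitInterval ≃o unitInterval) →* (unitInterval ≃ₜ unitInterval) where
  toFun f := f.toHomeomorph
  map_one' := rfl
  map_mul' _ _ := rfl

theorem orderIsoToHomeomorph_injective : Function.Injective orderIsoToHomeomorph := by
  intro f g h
  ext x
  exact congrArg Subtype.val (DFunLike.congr_fun h x)

/-- The standard generator `x₀` of Thompson's group. It sends `[0,1/2]`, `[1/2,3/4]`, `[3/4,1]`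
linearly onto `[0,1/4]`, `[1/4,1/2]`, `[1/2,1]`; being convex, it is a maximum of affine maps. -/
noncomputable def generatorZero : unitInterval ≃o unitInterval where
  toFun t := ⟨max (t / 2) (max (t - 1 / 4) (2 * t - 1)), by
    have h0 := t.2.1
    have h1 := t.2.2
    refine ⟨le_max_of_le_left (by linarith), ?_⟩
    simp only [max_le_iff]
    refine ⟨?_, ?_, ?_⟩ <;> linarith⟩
  invFun t := ⟨min (2 * t) (min (t + 1 / 4) ((t + 1) / 2)), by
    have h0 := t.2.1
    have h1 := t.2.2
    refine ⟨?_, min_le_of_right_le (min_le_of_right_le (by linarith))⟩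
    simp only [le_min_iff]
    refine ⟨?_, ?_, ?_⟩ <;> linarith⟩
  left_inv t := by
    apply Subtype.ext
    simp only [max_def, min_def]
    split_ifs <;> linarith
  right_inv t := by
    apply Subtype.ext
    simp only [max_def, min_def]
    split_ifs <;> linarith
  map_rel_iff' {s t} := by
    simp only [Equiv.coe_fn_mk, ← Subtype.coe_le_coe, max_def]
    constructor
    · intro h
      split_ifs at h <;> linarith
    · intro h
      split_ifs <;> linarith

theorem coe_generatorZero (t : unitInterval) :
    (generatorZero t : ℝ) = max (t / 2 : ℝ) (max (t - 1 / 4) (2 * t - 1)) := rfl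

/-- The point `2t - 1` of `[0,1]`, for `t ∈ [1/2,1]`. -/
noncomputable def stretch (t : unitInterval) (h : 1 / 2 ≤ (t : ℝ)) : unitInterval :=
  ⟨2 * t - 1, by linarith, by linarith [t.2.2]⟩

/-- The point `(1 + t)/2` of the right half of `[0,1]`. -/
noncomputable def shrink (t : unitInterval) : unitInterval :=
  ⟨(1 + t) / 2, by linarith [t.2.1], by linarith [t.2.2]⟩

/-- The map which is the identity on `[0,1/2]` and a scaled copy of `f` on `[1/2,1]`. -/
noncomputable def rightCopyFun (f : unitInterval → unitInterval) (t : unitInterval) :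
    unitInterval :=
  if h : 1 / 2 ≤ (t : ℝ) then shrink (f (stretch t h)) else t

theorem rightCopyFun_shrink (f : unitInterval → unitInterval) (t : unitInterval) :
    rightCopyFun f (shrink t) = shrink (f t) := by
  have h : 1 / 2 ≤ (shrink t : ℝ) := by
    simp only [shrink]
    linarith [t.2.1]
  rw [rightCopyFun, dif_pos h]
  congr 2
  apply Subtype.ext
  simp only [stretch, shrink]
  ring

theorem rightCopyFun_of_lt (f : unitInterval → unitInterval) {t : unitInterval}
    (h : (t : ℝ) < 1 / 2) : rightCopyFun f t = t := by
  rw [rightCopyFun, dif_neg (not_le.2 h)]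

/-- A point of `[0,1]` is left of `1/2` or in the scaled copy `[1/2,1]` of `[0,1]`. -/
theorem lt_half_or_exists_shrink (t : unitInterval) : (t : ℝ) < 1 / 2 ∨ ∃ s, t = shrink s := by
  rcases lt_or_ge (t : ℝ) (1 / 2) with h | h
  · exact .inl h
  · refine .inr ⟨stretch t h, Subtype.ext ?_⟩
    simp only [stretch, shrink]
    ring

theorem rightCopyFun_comp (f g : unitInterval → unitInterval) (t : unitInterval) :
    rightCopyFun f (rightCopyFun g t) = rightCopyFun (fun s => f (g s)) t := by
  rcases lt_half_or_exists_shrink t with h | ⟨s, rfl⟩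
  · rw [rightCopyFun_of_lt g h, rightCopyFun_of_lt f h, rightCopyFun_of_lt _ h]
  · simp only [rightCopyFun_shrink]

theorem rightCopyFun_id (t : unitInterval) : rightCopyFun (fun s => s) t = t := by
  rcases lt_half_or_exists_shrink t with h | ⟨s, rfl⟩
  · rw [rightCopyFun_of_lt _ h]
  · rw [rightCopyFun_shrink]

theorem rightCopyFun_monotone {f : unitInterval → unitInterval} (hf : Monotone f) :
    Monotone (rightCopyFun f) := by
  intro s t hst
  have hst' : (s : ℝ) ≤ t := hst
  rcases lt_half_or_exists_shrink s with h | ⟨s, rfl⟩ <;>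
    rcases lt_half_or_exists_shrink t with h' | ⟨t, rfl⟩
  · rwa [rightCopyFun_of_lt _ h, rightCopyFun_of_lt _ h']
  · rw [rightCopyFun_of_lt _ h, rightCopyFun_shrink, ← Subtype.coe_le_coe]
    simp only [shrink]
    linarith [(f t).2.1]
  · simp only [shrink] at hst'
    linarith [s.2.1]
  · rw [rightCopyFun_shrink, rightCopyFun_shrink, ← Subtype.coe_le_coe]
    have : s ≤ t := by
      rw [← Subtype.coe_le_coe]
      simp only [shrink] at hst'
      linarith
    have : (f s : ℝ) ≤ f t := hf this
    simp only [shrink]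
    linarith

/-- The homomorphism sending `f` to its copy on `[1/2,1]`, extended by the identity. -/
noncomputable def rightCopy :
    (unitInterval ≃o unitInterval) →* (unitInterval ≃o unitInterval) where
  toFun f := Equiv.toOrderIso
    { toFun := rightCopyFun f
      invFun := rightCopyFun f.symm
      left_inv := fun t => by simp [rightCopyFun_comp, rightCopyFun_id]
      right_inv := fun t => by simp [rightCopyFun_comp, rightCopyFun_id] }
    (rightCopyFun_monotone f.monotone) (rightCopyFun_monotone f.symm.monotone)
  map_one' := by
    ext t
    exact congrArg Subtype.val (rightCopyFun_id t)
  map_mul' f g := by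
    ext t
    exact congrArg Subtype.val (rightCopyFun_comp f g t).symm

theorem rightCopy_apply (f : unitInterval ≃o unitInterval) (t : unitInterval) :
    rightCopy f t = rightCopyFun f t := rfl

theorem rightCopy_injective : Function.Injective rightCopy := by
  intro f g h
  ext t
  have h' := congrArg Subtype.val (DFunLike.congr_fun h (shrink t))
  simp only [rightCopy_apply, rightCopyFun_shrink] at h'
  simp only [shrink] at h'
  linarith

/-- On `[3/4,1]`, the generator `x₀` is the scaling onto `[1/2,1]`. -/
theorem generatorZero_shrink_shrink (t : unitInterval) :
    generatorZero (shrink (shrink t)) = shrink t := by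
  apply Subtype.ext
  have := t.2.1
  simp only [coe_generatorZero, shrink, max_def]
  split_ifs <;> linarith

/-- Conjugation by `x₀` maps `[1/2,1]` to `[3/4,1]`, so that it shifts copies to the right. -/
theorem rightCopy_mul_generatorZero (f : unitInterval ≃o unitInterval) :
    rightCopy f * generatorZero = generatorZero * rightCopy (rightCopy f) := by
  ext t
  congr 1
  simp only [RelIso.mul_apply, rightCopy_apply]
  have small : ∀ t : unitInterval, (t : ℝ) < 3 / 4 → (generatorZero t : ℝ) < 1 / 2 := by
    intro t ht
    have := t.2.1
    simp only [coe_generatorZero, max_lt_iff]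
    refine ⟨?_, ?_, ?_⟩ <;> linarith
  rcases lt_half_or_exists_shrink t with h | ⟨t, rfl⟩
  · rw [rightCopyFun_of_lt _ h, rightCopyFun_of_lt _ (small t (by linarith))]
  · rcases lt_half_or_exists_shrink t with h | ⟨t, rfl⟩
    · rw [rightCopyFun_shrink, rightCopy_apply, rightCopyFun_of_lt _ h, rightCopyFun_of_lt]
      apply small
      simp only [shrink]
      linarith
    · rw [rightCopyFun_shrink, rightCopy_apply, rightCopyFun_shrink,
        generatorZero_shrink_shrink, generatorZero_shrink_shrink, rightCopyFun_shrink]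

theorem generatorZero_lt {t : unitInterval} (h0 : 0 < (t : ℝ)) (h1 : (t : ℝ) < 1) :
    0 < (generatorZero t : ℝ) ∧ (generatorZero t : ℝ) < t := by
  simp only [coe_generatorZero, max_lt_iff, lt_max_iff]
  refine ⟨.inl (by linarith), ?_, ?_, ?_⟩ <;> linarith

/-- No nontrivial power of `x₀` fixes a point of the open interval. -/
theorem generatorZero_pow_lt (n : ℕ) {t : unitInterval} (h0 : 0 < (t : ℝ)) (h1 : (t : ℝ) < 1) :
    0 < ((generatorZero ^ (n + 1)) t : ℝ) ∧ ((generatorZero ^ (n + 1)) t : ℝ) < t := by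
  induction n with
  | zero => simpa using generatorZero_lt h0 h1
  | succ n ih =>
    rw [pow_succ', RelIso.mul_apply]
    have := generatorZero_lt ih.1 (ih.2.trans h1)
    exact ⟨this.1, this.2.trans ih.2⟩

/-- The standard generators `x_n` of Thompson's group. -/
noncomputable def generator (n : ℕ) : unitInterval ≃o unitInterval := rightCopy^[n] generatorZero

theorem generator_succ (n : ℕ) : generator (n + 1) = rightCopy (generator n) :=
  Function.iterate_succ_apply' _ _ _

theorem generator_mul_generator {n k : ℕ} (h : k < n) :
    generator n * generator k = generator k * generator (n + 1) := by
  induction k generalizing n with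
  | zero =>
    obtain ⟨m, rfl⟩ := Nat.exists_eq_add_of_lt h
    rw [generator_succ (0 + m + 1), generator_succ (0 + m)]
    exact rightCopy_mul_generatorZero _
  | succ k ih =>
    obtain ⟨m, rfl⟩ := Nat.exists_eq_add_of_lt h
    have := ih (n := k + m + 1) (by omega)
    rw [show k + 1 + m + 1 = (k + m + 1) + 1 by omega, generator_succ k,
      generator_succ (k + m + 1), generator_succ (k + m + 1 + 1), ← map_mul, ← map_mul, this]

end ThompsonF

/-! ### The structure group -/

namespace thompsonBraiding

open ThompsonF

theorem lift_relation {G : Type*} [Group G] {g : ℕ → G}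
    (hg : ∀ n k, k < n → g n * g k = g k * g (n + 1)) :
    ∀ w ∈ {w : FreeGroup ℕ | ∃ x y u v, thompsonBraiding.r (x, y) = some (u, v) ∧
      w = FreeGroup.of x * FreeGroup.of y * (FreeGroup.of u * FreeGroup.of v)⁻¹},
    FreeGroup.lift g w = 1 := by
  rintro w ⟨n, k, u, v, h, rfl⟩
  simp only [map_mul, map_inv, FreeGroup.lift_apply_of]
  rw [mul_inv_eq_one]
  rcases r_eq_some_iff.1 h with ⟨h', rfl, rfl⟩ | ⟨rfl, rfl, rfl⟩ | ⟨h', rfl, rfl⟩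
  · exact hg _ _ h'
  · rfl
  · exact (hg _ _ (by omega)).symm

/-- The generators of the structure group. -/
def gen (n : ℕ) : thompsonBraiding.StructureGroup := PresentedGroup.of n

theorem closure_range_gen : Subgroup.closure (Set.range gen) = ⊤ :=
  PresentedGroup.closure_range_of _

theorem gen_mul_gen {n k : ℕ} (h : k < n) : gen n * gen k = gen k * gen (n + 1) := by
  rw [← mul_inv_eq_one]
  exact PresentedGroup.one_of_mem (rels := {w : FreeGroup ℕ | ∃ x y u v,
      thompsonBraiding.r (x, y) = some (u, v) ∧
        w = FreeGroup.of x * FreeGroup.of y * (FreeGroup.of u * FreeGroup.of v)⁻¹})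
    ⟨n, k, k, n + 1, r_eq_some_iff.2 (.inl ⟨h, rfl, rfl⟩), rfl⟩

/-- The endomorphism `x_n ↦ x_{n+1}` of the structure group. -/
def shift : thompsonBraiding.StructureGroup →* thompsonBraiding.StructureGroup :=
  PresentedGroup.toGroup (f := fun n => gen (n + 1))
    (lift_relation fun _ _ h => gen_mul_gen (Nat.succ_lt_succ h))

theorem shift_gen (n : ℕ) : shift (gen n) = gen (n + 1) := PresentedGroup.toGroup.of _

/-- The representation of the structure group by increasing bijections of `[0,1]`. -/
noncomputable def toOrderIso :
    thompsonBraiding.StructureGroup →* (unitInterval ≃o unitInterval) :=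
  PresentedGroup.toGroup (f := generator) (lift_relation fun _ _ => generator_mul_generator)

theorem toOrderIso_gen (n : ℕ) : toOrderIso (gen n) = generator n := PresentedGroup.toGroup.of _

theorem toOrderIso_shift (g : thompsonBraiding.StructureGroup) :
    toOrderIso (shift g) = rightCopy (toOrderIso g) := by
  have : toOrderIso.comp shift = rightCopy.comp toOrderIso := by
    apply PresentedGroup.ext
    intro n
    change toOrderIso (shift (gen n)) = rightCopy (toOrderIso (gen n))
    rw [shift_gen, toOrderIso_gen, toOrderIso_gen, generator_succ]
  exact DFunLike.congr_fun this g

theorem shift_mul_gen_zero (g : thompsonBraiding.StructureGroup) :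
    shift g * gen 0 = gen 0 * shift (shift g) := by
  have : (MulAut.conj (gen 0)⁻¹).toMonoidHom.comp shift = shift.comp shift := by
    apply PresentedGroup.ext
    intro n
    change (gen 0)⁻¹ * shift (gen n) * (gen 0)⁻¹⁻¹ = shift (shift (gen n))
    rw [inv_inv, shift_gen, shift_gen, mul_assoc, gen_mul_gen n.succ_pos, inv_mul_cancel_left]
  have := DFunLike.congr_fun this g
  change (gen 0)⁻¹ * shift g * (gen 0)⁻¹⁻¹ = shift (shift g) at this
  rw [← this, inv_inv]
  group

theorem shift_mul_gen_zero_pow (g : thompsonBraiding.StructureGroup) (a : ℕ) :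
    shift g * gen 0 ^ a = gen 0 ^ a * shift (shift^[a] g) := by
  induction a generalizing g with
  | zero => simp
  | succ a ih =>
    rw [pow_succ', ← mul_assoc, shift_mul_gen_zero, mul_assoc, ih, ← mul_assoc,
      Function.iterate_succ_apply]

/-- The elements obtained from `1` by iterating `h ↦ x₀ᵃ s(h) x₀⁻ᵇ`, where `s` is the shift. -/
inductive HasNormalForm : thompsonBraiding.StructureGroup → Prop
  | one : HasNormalForm 1
  | step (a b : ℕ) {h} : HasNormalForm h → HasNormalForm (gen 0 ^ a * shift h * (gen 0 ^ b)⁻¹)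

theorem HasNormalForm.shift {g : thompsonBraiding.StructureGroup} (hg : HasNormalForm g) :
    HasNormalForm (shift g) := by
  simpa using HasNormalForm.step 0 0 hg

theorem HasNormalForm.iterate_shift {g : thompsonBraiding.StructureGroup} (hg : HasNormalForm g)
    (n : ℕ) : HasNormalForm (thompsonBraiding.shift^[n] g) := by
  induction n with
  | zero => exact hg
  | succ n ih =>
    rw [Function.iterate_succ_apply']
    exact ih.shift

theorem HasNormalForm.gen_zero_mul {g : thompsonBraiding.StructureGroup} (hg : HasNormalForm g) :
    HasNormalForm (gen 0 * g) := by
  cases hg with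
  | one => simpa using HasNormalForm.step 1 0 .one
  | step a b hh => simpa only [pow_succ', mul_assoc] using HasNormalForm.step (a + 1) b hh

theorem HasNormalForm.gen_zero_inv_mul {g : thompsonBraiding.StructureGroup}
    (hg : HasNormalForm g) : HasNormalForm ((gen 0)⁻¹ * g) := by
  cases hg with
  | one => simpa using HasNormalForm.step 0 1 .one
  | @step a b h hh =>
    cases a with
    | zero =>
      have := HasNormalForm.step 0 (b + 1) hh.shift
      rw [pow_zero, one_mul] at this ⊢
      rw [← mul_assoc]
      convert this using 1
      rw [pow_succ, mul_inv_rev, ← mul_assoc]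
      congr 1
      rw [inv_mul_eq_iff_eq_mul, ← mul_assoc, ← shift_mul_gen_zero, mul_inv_cancel_right]
    | succ a =>
      simpa only [pow_succ', mul_assoc, inv_mul_cancel_left] using HasNormalForm.step a b hh

/-- Left multiplication by `u = x_n^{±1}` preserves normal forms: for `n = 0` this is the
relation `x₀⁻¹ s(h) x₀ = s(s(h))`, and for `n > 0` one moves `u` past the power of `x₀` and inside
the shift. -/
theorem HasNormalForm.iterate_shift_mul {u : thompsonBraiding.StructureGroup}
    (hu : ∀ h, HasNormalForm h → HasNormalForm (u * h)) {g : thompsonBraiding.StructureGroup}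
    (hg : HasNormalForm g) (n : ℕ) : HasNormalForm (thompsonBraiding.shift^[n] u * g) := by
  induction hg generalizing n with
  | one =>
    rw [mul_one]
    exact (by simpa using hu 1 .one : HasNormalForm u).iterate_shift n
  | @step a b h hh ih =>
    cases n with
    | zero => exact hu _ (.step a b hh)
    | succ n =>
      rw [Function.iterate_succ_apply', ← mul_assoc, ← mul_assoc, shift_mul_gen_zero_pow,
        mul_assoc (gen 0 ^ a), ← map_mul, ← Function.iterate_add_apply]
      exact .step a b (ih _)

theorem gen_eq_iterate_shift (n : ℕ) : gen n = shift^[n] (gen 0) := by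
  induction n with
  | zero => rfl
  | succ n ih => rw [Function.iterate_succ_apply', ← ih, shift_gen]

theorem hasNormalForm (g : thompsonBraiding.StructureGroup) : HasNormalForm g := by
  have hg : g ∈ Subgroup.closure (Set.range gen) := by
    rw [closure_range_gen]
    trivial
  induction hg using Subgroup.closure_induction_left with
  | one => exact .one
  | mul_left x hx y _ hy =>
    obtain ⟨n, rfl⟩ := hx
    rw [gen_eq_iterate_shift]
    exact hy.iterate_shift_mul (fun _ => HasNormalForm.gen_zero_mul) n
  | inv_mul_cancel x hx y _ hy =>
    obtain ⟨n, rfl⟩ := hx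
    rw [gen_eq_iterate_shift, ← iterate_map_inv]
    exact hy.iterate_shift_mul (fun _ => HasNormalForm.gen_zero_inv_mul) n

/-- If `x₀ᵃ s(h) x₀⁻ᵇ` acts trivially, then evaluation at the fixed point `1/2` of `s(h)` shows
`a = b`, so that `h` acts trivially as well. -/
theorem toOrderIso_injective : Function.Injective toOrderIso := by
  rw [injective_iff_map_eq_one]
  intro g hg
  have hn := hasNormalForm g
  induction hn with
  | one => rfl
  | @step a b h _ ih =>
    have h0 : toOrderIso (gen 0) = generatorZero := toOrderIso_gen 0
    simp only [map_mul, map_inv, map_pow, toOrderIso_shift, h0] at hg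
    rw [mul_inv_eq_one] at hg
    let c : unitInterval := ⟨1 / 2, by norm_num, by norm_num⟩
    have hc0 : 0 < (c : ℝ) := by simp [c]
    have hc1 : (c : ℝ) < 1 := by norm_num [c]
    have hfix : ∀ f, rightCopy f c = c := by
      intro f
      have : c = shrink 0 := Subtype.ext (by simp [c, shrink])
      rw [this, rightCopy_apply, rightCopyFun_shrink]
      congr 1
      exact f.map_bot
    have hab : a = b := by
      have hval := DFunLike.congr_fun hg c
      rw [RelIso.mul_apply, hfix] at hval
      rcases lt_trichotomy a b with hlt | heq | hlt
      · obtain ⟨m, rfl⟩ := Nat.exists_eq_add_of_lt hlt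
        rw [add_assoc, pow_add, RelIso.mul_apply] at hval
        have := generatorZero_pow_lt m hc0 hc1
        rw [← (generatorZero ^ a).injective hval] at this
        exact absurd this.2 (lt_irrefl _)
      · exact heq
      · obtain ⟨m, rfl⟩ := Nat.exists_eq_add_of_lt hlt
        rw [add_assoc, pow_add, RelIso.mul_apply] at hval
        have := generatorZero_pow_lt m hc0 hc1
        rw [(generatorZero ^ b).injective hval] at this
        exact absurd this.2 (lt_irrefl _)
    subst hab
    rw [mul_eq_left, map_eq_one_iff _ rightCopy_injective] at hg
    rw [ih hg, map_one, mul_one, mul_inv_cancel]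

end thompsonBraiding

/-! ### Dyadic rearrangements -/

open ThompsonF thompsonBraiding

/-- The image of an interval under `t ↦ (1 + t)/2`. -/
noncomputable def shrinkInterval (I : ℝ × ℝ) : ℝ × ℝ := ((1 + I.1) / 2, (1 + I.2) / 2)

theorem MapsLinearly.shrink {f : unitInterval ≃o unitInterval} {I J : ℝ × ℝ}
    (h : MapsLinearly f I J) :
    MapsLinearly (rightCopy f) (shrinkInterval I) (shrinkInterval J) := by
  intro t ht
  obtain ⟨x, hx, hfx⟩ := h t ht
  refine ⟨ThompsonF.shrink x, ?_, ?_⟩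
  · simp only [ThompsonF.shrink, shrinkInterval, hx]
    ring
  · rw [rightCopy_apply, rightCopyFun_shrink]
    simp only [ThompsonF.shrink, shrinkInterval, hfx]
    ring

theorem mapsLinearly_one (I : ℝ × ℝ) (h0 : 0 ≤ I.1) (h : I.1 ≤ I.2) (h1 : I.2 ≤ 1) :
    MapsLinearly (1 : unitInterval ≃o unitInterval) I I := by
  intro t ht
  exact ⟨⟨I.1 + t * (I.2 - I.1), by nlinarith [ht.1], by nlinarith [ht.2]⟩, rfl, rfl⟩

theorem mapsLinearly_rightCopy_left (f : unitInterval ≃o unitInterval) :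
    MapsLinearly (rightCopy f) (0, 1 / 2) (0, 1 / 2) := by
  intro t ht
  refine ⟨⟨t / 2, by linarith [ht.1], by linarith [ht.2]⟩, ?_, ?_⟩
  · simp only
    ring
  · rcases ht.2.lt_or_eq with h | rfl
    · rw [rightCopy_apply, rightCopyFun_of_lt _ (by simp only; linarith)]
      simp only
      ring
    · have : (⟨1 / 2, by norm_num, by norm_num⟩ : unitInterval) = ThompsonF.shrink 0 :=
        Subtype.ext (by simp [ThompsonF.shrink])
      rw [this, rightCopy_apply, rightCopyFun_shrink, show f 0 = 0 from f.map_bot]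
      simp [ThompsonF.shrink]

/-- The copy of `f` on `[1/2,1]` is linear on `[0,1/2]` followed by the shrunken intervals. -/
theorem forall₂_rightCopy {f : unitInterval ≃o unitInterval} {D R : List (ℝ × ℝ)}
    (h : List.Forall₂ (MapsLinearly f) D R) :
    List.Forall₂ (MapsLinearly (rightCopy f))
      ((0, 1 / 2) :: D.map shrinkInterval) ((0, 1 / 2) :: R.map shrinkInterval) := by
  refine .cons (mapsLinearly_rightCopy_left f) ?_
  rw [List.forall₂_map_left_iff, List.forall₂_map_right_iff]
  exact h.imp fun _ _ => MapsLinearly.shrink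

theorem forall₂_mapsLinearly_comp {f g : unitInterval → unitInterval} {D R C : List (ℝ × ℝ)}
    (hf : List.Forall₂ (MapsLinearly f) D R) (hg : List.Forall₂ (MapsLinearly g) R C) :
    List.Forall₂ (MapsLinearly (g ∘ f)) D C := by
  induction hf generalizing C with
  | nil => cases hg; exact .nil
  | cons h₁ _ ih =>
    cases hg with
    | cons h₂ hs => exact .cons (h₁.comp h₂) (ih hs)

theorem CutStep.cons {D D' : List (ℝ × ℝ)} (h : CutStep D D') (I : ℝ × ℝ) :
    CutStep (I :: D) (I :: D') := by
  cases h with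
  | cut L R a b => exact CutStep.cut (I :: L) R a b

theorem CutStep.map_shrinkInterval {D D' : List (ℝ × ℝ)} (h : CutStep D D') :
    CutStep (D.map shrinkInterval) (D'.map shrinkInterval) := by
  cases h with
  | cut L R a b =>
    have := CutStep.cut (L.map shrinkInterval) (R.map shrinkInterval) ((1 + a) / 2) ((1 + b) / 2)
    have e : ((1 + a) / 2 + (1 + b) / 2) / 2 = (1 + (a + b) / 2) / 2 := by ring
    rw [e] at this
    simpa [shrinkInterval] using this

theorem isDyadicSubdivision_halves : IsDyadicSubdivision [(0, 1 / 2), (1 / 2, 1)] := by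
  have := CutStep.cut [] [] (0 : ℝ) 1
  rw [zero_add] at this
  exact .single this

theorem IsDyadicSubdivision.shrink {D : List (ℝ × ℝ)} (hD : IsDyadicSubdivision D) :
    IsDyadicSubdivision ((0, 1 / 2) :: D.map shrinkInterval) := by
  refine isDyadicSubdivision_halves.trans ?_
  have : Relation.ReflTransGen CutStep ((0, 1 / 2) :: [(0, 1)].map shrinkInterval)
      ((0, 1 / 2) :: D.map shrinkInterval) := Relation.ReflTransGen.lift
    (fun D : List (ℝ × ℝ) => ((0 : ℝ), (1 / 2 : ℝ)) :: D.map shrinkInterval)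
    (fun _ _ h => CutStep.cons (CutStep.map_shrinkInterval h) _) _ _ hD
  simpa [shrinkInterval] using this

theorem IsDyadicRearrangement.rightCopy {f : unitInterval ≃o unitInterval}
    (hf : IsDyadicRearrangement f) : IsDyadicRearrangement (ThompsonF.rightCopy f) := by
  obtain ⟨D, R, hD, hR, h⟩ := hf
  exact ⟨_, _, hD.shrink, hR.shrink, forall₂_rightCopy h⟩

theorem generatorZero_mapsLinearly_first : MapsLinearly generatorZero (0, 1 / 2) (0, 1 / 4) := by
  intro t ht
  refine ⟨⟨t / 2, by linarith [ht.1], by linarith [ht.2]⟩, by simp only; ring, ?_⟩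
  have := ht.2
  simp only [coe_generatorZero, max_def]
  split_ifs <;> linarith

theorem generatorZero_mapsLinearly_second :
    MapsLinearly generatorZero (1 / 2, 3 / 4) (1 / 4, 1 / 2) := by
  intro t ht
  refine ⟨⟨1 / 2 + t / 4, by linarith [ht.1], by linarith [ht.2]⟩, by simp only; ring, ?_⟩
  have := ht.1
  have := ht.2
  simp only [coe_generatorZero, max_def]
  split_ifs <;> linarith

theorem generatorZero_mapsLinearly_shrink {I : ℝ × ℝ}
    (hI : MapsLinearly (1 : unitInterval ≃o unitInterval) I I) :
    MapsLinearly generatorZero (shrinkInterval (shrinkInterval I)) (shrinkInterval I) := by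
  intro t ht
  obtain ⟨x, hx, -⟩ := hI t ht
  refine ⟨ThompsonF.shrink (ThompsonF.shrink x), ?_, ?_⟩
  · simp only [ThompsonF.shrink, shrinkInterval, hx]
    ring
  · rw [generatorZero_shrink_shrink]
    simp only [ThompsonF.shrink, shrinkInterval, hx]
    ring

/-- The subdivision `[0,1/2], [1/2,3/4], …` of `[0,1]` into `n + 1` intervals, of which always
the last is cut. -/
noncomputable def comb : ℕ → List (ℝ × ℝ)
  | 0 => [(0, 1)]
  | n + 1 => (0, 1 / 2) :: (comb n).map shrinkInterval

theorem length_comb (n : ℕ) : (comb n).length = n + 1 := by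
  induction n with
  | zero => rfl
  | succ n ih => simp [comb, ih]

theorem forall₂_one_comb (n : ℕ) :
    List.Forall₂ (MapsLinearly (1 : unitInterval ≃o unitInterval)) (comb n) (comb n) := by
  induction n with
  | zero => exact .cons (mapsLinearly_one _ le_rfl zero_le_one le_rfl) .nil
  | succ n ih =>
    have := forall₂_rightCopy ih
    rwa [map_one] at this

theorem isDyadicRearrangement_generatorZero : IsDyadicRearrangement generatorZero := by
  have hR : IsDyadicSubdivision [(0, 1 / 4), (1 / 4, 1 / 2), (1 / 2, 1)] := by
    have := CutStep.cut [] [(1 / 2, 1)] (0 : ℝ) (1 / 2)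
    norm_num at this
    exact isDyadicSubdivision_halves.tail (by norm_num; exact this)
  refine ⟨(0, 1 / 2) :: [(0, 1 / 2), (1 / 2, 1)].map shrinkInterval, _,
    isDyadicSubdivision_halves.shrink, hR, ?_⟩
  have h := generatorZero_mapsLinearly_shrink
    (mapsLinearly_one (0, 1) le_rfl zero_le_one le_rfl)
  have h' := generatorZero_mapsLinearly_second
  norm_num [shrinkInterval] at h h' ⊢
  refine ⟨by simpa using generatorZero_mapsLinearly_first, h', h⟩

theorem isDyadicRearrangement_generator (n : ℕ) : IsDyadicRearrangement (generator n) := by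
  induction n with
  | zero => exact isDyadicRearrangement_generatorZero
  | succ n ih =>
    rw [generator_succ]
    exact ih.rightCopy

theorem isDyadicRearrangement_toOrderIso (g : thompsonBraiding.StructureGroup) :
    orderIsoToHomeomorph (toOrderIso g) ∈ ThompsonF := by
  have hg : g ∈ Subgroup.closure (Set.range gen) := by
    rw [closure_range_gen]
    trivial
  induction hg using Subgroup.closure_induction with
  | mem x hx =>
    obtain ⟨n, rfl⟩ := hx
    rw [toOrderIso_gen]
    exact isDyadicRearrangement_generator n
  | one => simp
  | mul x y _ _ hx hy => simpa using ThompsonF.mul_mem hx hy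
  | inv x _ hx => simpa using ThompsonF.inv_mem hx

/-! ### The generators act transitively on subdivisions -/

/-- A single cut of the domain subdivision is carried to a single cut of the range subdivision. -/
theorem CutStep.exists_cutStep_range {f : unitInterval → unitInterval} {D D' R : List (ℝ × ℝ)}
    (hD : CutStep D D') (h : List.Forall₂ (MapsLinearly f) D R) :
    ∃ R', CutStep R R' ∧ List.Forall₂ (MapsLinearly f) D' R' := by
  cases hD with
  | cut L M a b =>
    have h1 := List.forall₂_take_append R L ((a, b) :: M) (List.Forall₂.flip (R := flip _) h)
    have h2 := List.forall₂_drop_append R L ((a, b) :: M) (List.Forall₂.flip (R := flip _) h)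
    have e := List.take_append_drop L.length R
    generalize List.take L.length R = P at h1 e
    generalize List.drop L.length R = Q at h2 e
    subst e
    cases h2 with
    | @cons p _ Q _ hp hQ =>
      exact ⟨_, CutStep.cut P Q p.1 p.2, List.rel_append h1.flip (.cons (MapsLinearly.left hp)
        (.cons (MapsLinearly.right hp) hQ.flip))⟩

theorem not_cutStep_nil {D : List (ℝ × ℝ)} : ¬ CutStep [] D := by
  intro h
  generalize hA : [] = A at h
  cases h with
  | cut L R a b => cases L <;> simp at hA

theorem cutStep_cons_iff {I : ℝ × ℝ} {D D' : List (ℝ × ℝ)} : CutStep (I :: D) D' ↔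
    D' = (I.1, (I.1 + I.2) / 2) :: ((I.1 + I.2) / 2, I.2) :: D ∨
      ∃ E, CutStep D E ∧ D' = I :: E := by
  constructor
  · intro h
    generalize hA : I :: D = A at h
    cases h with
    | cut L R a b =>
      cases L with
      | nil =>
        simp only [List.nil_append, List.cons.injEq] at hA
        obtain ⟨rfl, rfl⟩ := hA
        exact .inl rfl
      | cons p L =>
        simp only [List.cons_append, List.cons.injEq] at hA
        obtain ⟨rfl, rfl⟩ := hA
        exact .inr ⟨_, CutStep.cut L R a b, rfl⟩
  · rintro (rfl | ⟨E, h, rfl⟩)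
    · exact CutStep.cut [] D I.1 I.2
    · exact h.cons I

theorem CutStep.exists_of_map_shrinkInterval {D E : List (ℝ × ℝ)}
    (h : CutStep (D.map shrinkInterval) E) : ∃ D', CutStep D D' ∧ E = D'.map shrinkInterval := by
  induction D generalizing E with
  | nil => exact (not_cutStep_nil h).elim
  | cons I D ih =>
    rw [List.map_cons, cutStep_cons_iff] at h
    rcases h with rfl | ⟨E, h, rfl⟩
    · refine ⟨_, cutStep_cons_iff.2 (.inl rfl), ?_⟩
      simp only [shrinkInterval, List.map_cons, List.cons.injEq, Prod.mk.injEq, true_and, and_true]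
      constructor <;> ring
    · obtain ⟨D', h', rfl⟩ := ih h
      exact ⟨_, h'.cons I, rfl⟩

/-- A comb with one interval cut is sent to the next comb by an element of the group generated by
the `x_n`: cutting the last interval gives the next comb, and if the `i`-th of the other intervals
is cut, then `x_i⁻¹` will do. -/
theorem exists_map_cut_comb {n : ℕ} {D : List (ℝ × ℝ)} (h : CutStep (comb n) D) :
    ∃ g, List.Forall₂ (MapsLinearly (toOrderIso g)) D (comb (n + 1)) := by
  induction n generalizing D with
  | zero =>
    refine ⟨1, ?_⟩
    have : D = comb 1 := by
      rcases cutStep_cons_iff.1 (show CutStep [(0, 1)] D from h) with rfl | ⟨E, hE, rfl⟩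
      · norm_num [comb, shrinkInterval]
      · exact (not_cutStep_nil hE).elim
    rw [map_one, this]
    exact forall₂_one_comb 1
  | succ n ih =>
    rcases cutStep_cons_iff.1 h with rfl | ⟨E, hE, rfl⟩
    · refine ⟨(gen 0)⁻¹, ?_⟩
      have key : List.Forall₂ (MapsLinearly generatorZero) (comb (n + 2))
          ((0, (0 + 1 / 2) / 2) :: ((0 + 1 / 2) / 2, 1 / 2) :: (comb n).map shrinkInterval) := by
        have h1 := generatorZero_mapsLinearly_first
        have h2 := generatorZero_mapsLinearly_second
        refine .cons ?_ (.cons ?_ ?_)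
        · norm_num at h1 ⊢
          exact h1
        · norm_num [shrinkInterval] at h2 ⊢
          exact h2
        · rw [List.forall₂_map_left_iff, List.forall₂_map_left_iff, List.forall₂_map_right_iff]
          have := forall₂_one_comb n
          rw [List.forall₂_same] at this ⊢
          exact fun I hI => generatorZero_mapsLinearly_shrink (this I hI)
      rw [map_inv, toOrderIso_gen]
      exact List.Forall₂.flip (key.imp fun _ _ =>
        MapsLinearly.symm (f := orderIsoToHomeomorph generatorZero))
    · obtain ⟨D', hD', rfl⟩ := hE.exists_of_map_shrinkInterval
      obtain ⟨g, hg⟩ := ih hD'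
      refine ⟨shift g, ?_⟩
      rw [toOrderIso_shift]
      exact forall₂_rightCopy hg

theorem IsDyadicSubdivision.exists_map_comb {D : List (ℝ × ℝ)} (hD : IsDyadicSubdivision D) :
    ∃ n g, List.Forall₂ (MapsLinearly (toOrderIso g)) D (comb n) := by
  induction hD with
  | refl => exact ⟨0, 1, by rw [map_one]; exact forall₂_one_comb 0⟩
  | tail _ hs ih =>
    obtain ⟨n, g, hg⟩ := ih
    obtain ⟨R, hR, h⟩ := hs.exists_cutStep_range hg
    obtain ⟨k, hk⟩ := exists_map_cut_comb hR
    refine ⟨n + 1, k * g, ?_⟩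
    rw [map_mul]
    exact forall₂_mapsLinearly_comp (g := toOrderIso k) h hk

theorem IsDyadicSubdivision.exists_mem {D : List (ℝ × ℝ)} (hD : IsDyadicSubdivision D)
    (x : unitInterval) : ∃ I ∈ D, ∃ t ∈ Set.Icc (0 : ℝ) 1, (x : ℝ) = I.1 + t * (I.2 - I.1) := by
  induction hD with
  | refl => exact ⟨(0, 1), by simp, x, x.2, by simp⟩
  | tail _ hs ih =>
    obtain ⟨I, hI, t, ht, hx⟩ := ih
    cases hs with
    | cut L R a b =>
      rw [List.mem_append, List.mem_cons] at hI
      rcases hI with hI | rfl | hI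
      · exact ⟨I, by simp [hI], t, ht, hx⟩
      · rcases le_total t (1 / 2) with h | h
        · refine ⟨(a, (a + b) / 2), by simp, 2 * t, ⟨by linarith [ht.1], by linarith⟩, ?_⟩
          rw [hx]
          ring
        · refine ⟨((a + b) / 2, b), by simp, 2 * t - 1, ⟨by linarith, by linarith [ht.2]⟩, ?_⟩
          rw [hx]
          ring
      · exact ⟨I, by simp [hI], t, ht, hx⟩

/-- Two maps that send the intervals of a subdivision linearly to the same intervals agree. -/
theorem IsDyadicSubdivision.eq_of_forall₂ {f g : unitInterval → unitInterval}
    {D R : List (ℝ × ℝ)} (hD : IsDyadicSubdivision D) (hf : List.Forall₂ (MapsLinearly f) D R)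
    (hg : List.Forall₂ (MapsLinearly g) D R) (x : unitInterval) : f x = g x := by
  obtain ⟨I, hI, t, ht, hx⟩ := hD.exists_mem x
  clear hD
  induction hf with
  | nil => simp at hI
  | cons h₁ _ ih =>
    cases hg with
    | cons h₂ hs =>
      rcases List.mem_cons.1 hI with rfl | hI
      · obtain ⟨y, hy, hfy⟩ := h₁ t ht
        obtain ⟨z, hz, hgz⟩ := h₂ t ht
        obtain rfl : y = x := Subtype.ext (hy.trans hx.symm)
        obtain rfl : z = y := Subtype.ext (hz.trans hx.symm)
        exact Subtype.ext (hfy.trans hgz.symm)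
      · exact ih hs hI

theorem exists_toOrderIso_eq {f : unitInterval ≃ₜ unitInterval} (hf : f ∈ ThompsonF) :
    ∃ g, orderIsoToHomeomorph (toOrderIso g) = f := by
  obtain ⟨D, R, hD, hR, h⟩ := hf
  obtain ⟨m, g, hg⟩ := hD.exists_map_comb
  obtain ⟨n, k, hk⟩ := hR.exists_map_comb
  have hmn : m = n := by
    have := hg.length_eq.symm.trans (h.length_eq.trans hk.length_eq)
    rw [length_comb, length_comb] at this
    omega
  subst hmn
  have hkf : List.Forall₂ (MapsLinearly (toOrderIso k ∘ f)) D (comb m) :=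
    forall₂_mapsLinearly_comp h hk
  refine ⟨k⁻¹ * g, ?_⟩
  rw [map_mul, map_inv, map_mul, map_inv, inv_mul_eq_iff_eq_mul]
  ext x
  exact congrArg Subtype.val (hD.eq_of_forall₂ hg hkf x)

/-- The structure group of `𝓕` is Thompson's group. -/
noncomputable def structureGroupEquivThompsonF : thompsonBraiding.StructureGroup ≃* ThompsonF :=
  MulEquiv.ofBijective
    ((orderIsoToHomeomorph.comp toOrderIso).codRestrict ThompsonF isDyadicRearrangement_toOrderIso)
    ⟨fun _ _ h => toOrderIso_injective (orderIsoToHomeomorph_injective (congrArg Subtype.val h)),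
      fun f => (exists_toOrderIso_eq f.2).imp fun _ h => Subtype.ext h⟩

theorem theorem3 :
    -- `𝓕` is a square-free, non-degenerate, involutive partial set-theoretic solution
    thompsonBraiding.IsPartialSolution ∧
    thompsonBraiding.SquareFree ∧
    -- the structure group
    Nonempty (thompsonBraiding.StructureGroup ≃* ThompsonF) ∧
    -- the structure inverse monoid
    IsInverseMonoid thompsonBraiding.StructureInverseMonoid ∧
    IsInverseMonoid (RestrictedInverseProduct ℕ) ∧
    (∃ ψ : thompsonBraiding.StructureInverseMonoid →* RestrictedInverseProduct ℕ,
      Function.Injective ψ) ∧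
    -- further properties
    thompsonBraiding.Irretractable ∧
    thompsonBraiding.Decomposable ∧
    (∃ star : ℕ → ℕ → ℕ,
      thompsonBraiding.InducesOperation star ∧
      IsPartialCycleSet star ∧
      (∀ n, Set.BijOn (star n) Set.univ {n + 1}ᶜ) ∧
      Function.Bijective (fun n => star n n) ∧
      (∀ n, star n n = n)) := by
  exact ⟨thompsonBraiding.isPartialSolution, thompsonBraiding.squareFree,
    ⟨structureGroupEquivThompsonF⟩, isInverseMonoid_structureInverseMonoid _,
    RestrictedInverseProduct.isInverseMonoid ℕ, thompsonBraiding.exists_embedding,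
    PartialBraiding.irretractable_of_σ_injective thompsonBraiding.σ_injective,
    thompsonBraiding.decomposable, thompsonBraiding.star,
    thompsonBraiding.inducesOperation_star, thompsonBraiding.isPartialCycleSet_star,
    thompsonBraiding.bijOn_star,
    by simp only [thompsonBraiding.star_self]; exact Function.bijective_id,
    thompsonBraiding.star_self⟩
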